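/- Let $G$ be a finite graph whose vertex set is partitioned into $r$ independent sets (parts) $V_1,\dots,V_r$ (an $r$-partite graph). For an integer $t\ge 0$, a $t$-IT (independent $t$-transversal) of $G$ is an independent set of size $t$ that contains at most one vertex of each part. For integers $r\ge D\ge 1$ and $\Delta\ge 0$, let $n(r,D,\Delta)$ be the largest integer $n\ge 0$ such that there is an $r$-partite graph with at least $n$ vertices in each part, with maximum degree $\Delta$, and without an $(r-D+1)$-IT. **Theorem 1.3.** Let $r,d,q\ge 0$ be integers such that $r=q(d+1)$, where $q\ge 3$ is odd, and let $\Delta\ge 0$ be an integer. Then $n(r,d+1,\Delta)$ exists (that is, there is a largest such $n$) and \[ n(r,d+1,\Delta)\le\max\left\{2\Delta\left(1-\frac{4d+5}{4r}\right),\ 2\Delta\left(1-\frac{q}{q^2-1}\right)\right\}. \] -/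

import Mathlib

/-- Let `G` be an `r`-partite graph, the partition into `r` independent (possibly empty) parts being
the fibres of the proper colouring `c`. `IsPartialIT G c t S` says that `S` is an independent
`t`-transversal (a `t`-IT): an independent set consisting of one vertex from each of `t` parts,
i.e. an independent set of size `t` meeting each part in at most one vertex. -/
def IsPartialIT {V : Type*} {r : ℕ} (G : SimpleGraph V) (c : G.Coloring (Fin r)) (t : ℕ)
    (S : Finset V) : Prop :=
  G.IsIndepSet (S : Set V) ∧ Set.InjOn c (S : Set V) ∧ S.card = t

/-- The set of all `n` such that there is a (finite) `r`-partite graph `G` with at least `n`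
vertices in each part, maximum degree `Δ`, and without an `(r - D + 1)`-IT. -/
def constructionSizes (r D Δ : ℕ) : Set ℕ :=
  {n | ∃ (V : Type) (_ : Fintype V) (G : SimpleGraph V) (_ : DecidableRel G.Adj)
      (c : G.Coloring (Fin r)),
      (∀ i : Fin r, n ≤ (c.colorClass i).ncard) ∧
      G.maxDegree = Δ ∧
      ¬ ∃ S : Finset V, IsPartialIT G c (r + 1 - D) S}

/-- The extremal function `n(r, D, Δ)`: the largest element of `constructionSizes r D Δ`, written as
a supremum in `ℕ`. It is the largest element whenever one exists; the theorem asserts that it does. -/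
noncomputable def extremalSize (r D Δ : ℕ) : ℕ := sSup (constructionSizes r D Δ)

/-! Assume n exceeds the first term of the maximum, and put t = 2Δ - n. Let M be the set of colours
missed by a largest partial transversal, so |M| ≥ d+1. From the colours of M one grows a star forest
with centres X and leaves W, the leaves lying in a maximum transversal J. When it cannot grow
further, X ∪ W dominates every vertex of the active colours Y = M ∪ col(W) (`exists_dominating`).
Since |Y| = |M| + |W| and |X| ≤ |W|, counting domination gives Δ(2|Y| - |X| - |W|) ≤ t|Y|. Exceeding
the first term forces |M| = d+1 and |X| = |W|, so every star is a single edge.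

The active colours then split into d+1 blocks, one for each root in M. Call a vertex of an active
colour spoiled if it has a neighbour in J outside its block. Two facts oppose each other. A spoiled
vertex has at least two neighbours in X ∪ J, since otherwise alternating along the matching edges
enlarges the transversal; hence few vertices are spoiled (`two_le_of_spoiled`). But a block without
its spoiled vertices has no full transversal, since one could replace the part of J in that block
and gain a colour; hence many vertices are spoiled (`not_fullIT_block`, `deletion_bound`). Adding up
over the blocks gives 2Δq ≤ t(q²-1), the second term.

The lower bound on deletions comes from the topological Hall theorem. If there is no transversal,
some set Z of colours spans a graph whose independence complex has nonvanishing homology below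
dimension |Z| - 1, and Meshulam's edge explosions bound its size by 2Δ(|Z|-1)
(`exists_card_colored_le`). For blocks of exactly q colours this is too weak, and stability is used:
near equality forces a cover by |C|-1 bicliques, with edges only inside classes for an edge-minimal
example. A minimal tight set of colours splits such a structure into two sets of colours. As q is
odd, one of them has fewer than q/2 colours, and it turns out to have too few vertices
(`fullIT_of_odd`). -/

set_option linter.unusedSectionVars false

/-! ### Homology of independence complexes modulo two, and edge explosions -/

section Chains

variable {V : Type*} [Fintype V] [DecidableEq V]

/-- The simplicial boundary, modulo two, of a chain on the subsets of `V`. -/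
def bdry (c : Finset V → ZMod 2) (σ : Finset V) : ZMod 2 := ∑ v ∈ σᶜ, c (insert v σ)

/-- `c` is a chain on the independent sets of `H` of size `j` that lie in `W`. -/
def IndepChain (H : SimpleGraph V) (W : Finset V) (j : ℕ) (c : Finset V → ZMod 2) : Prop :=
  ∀ σ, c σ ≠ 0 → σ ⊆ W ∧ H.IsIndepSet (σ : Set V) ∧ σ.card = j

/-- The reduced homology of the independence complex of `H[W]` vanishes in dimension `j - 1`. -/
def Fills (H : SimpleGraph V) (W : Finset V) (j : ℕ) : Prop :=
  ∀ z, IndepChain H W j z → bdry z = 0 → ∃ c, IndepChain H W (j + 1) c ∧ bdry c = z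

/-- The independence complex of `H[W]` has nonvanishing reduced homology in some dimension
less than `k`. -/
def NonFilling (H : SimpleGraph V) (W : Finset V) (k : ℕ) : Prop :=
  ∃ j ≤ k, ¬ Fills H W j

/-- The neighbours of `v` in `W`. -/
noncomputable def nbr (H : SimpleGraph V) (W : Finset V) (v : V) : Finset V := by
  classical exact W.filter (fun w => H.Adj v w)

theorem mem_nbr {H : SimpleGraph V} {W : Finset V} {v w : V} :
    w ∈ nbr H W v ↔ w ∈ W ∧ H.Adj v w := by
  classical simp [nbr]

theorem bdry_add (c e : Finset V → ZMod 2) : bdry (c + e) = bdry c + bdry e := by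
  funext σ; simp [bdry, Finset.sum_add_distrib]

theorem bdry_bdry (c : Finset V → ZMod 2) : bdry (bdry c) = 0 := by
  funext σ
  simp only [bdry, Pi.zero_apply]
  rw [Finset.sum_sigma']
  refine Finset.sum_involution (fun p _ => ⟨p.2, p.1⟩) ?_ ?_ ?_ ?_
  · rintro ⟨v, w⟩ _
    simp only [Finset.insert_comm w v]
    exact CharTwo.add_self_eq_zero _
  · rintro ⟨v, w⟩ h _ he
    simp only [Finset.mem_sigma, Finset.mem_compl, Finset.mem_insert, not_or, Sigma.mk.injEq] at h he
    exact h.2.1 he.1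
  · rintro ⟨v, w⟩ h
    simp only [Finset.mem_sigma, Finset.mem_compl, Finset.mem_insert, not_or] at h ⊢
    exact ⟨h.2.2, fun e => h.2.1 e.symm, h.1⟩
  · rintro ⟨v, w⟩ _; rfl

/-- The independence complex is a cone with apex x, and coning a cycle from x fills it. -/
theorem fills_of_isolated {H : SimpleGraph V} {W : Finset V} {x : V} (hx : x ∈ W)
    (hiso : ∀ w ∈ W, ¬ H.Adj x w) (j : ℕ) : Fills H W j := by
  intro z hz hzc
  refine ⟨fun σ => if x ∈ σ then z (σ.erase x) else 0, ?_, ?_⟩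
  · intro σ hσ
    simp only [ne_eq, ite_eq_right_iff, Classical.not_imp] at hσ
    obtain ⟨hxσ, h⟩ := hσ
    obtain ⟨h1, h2, h3⟩ := hz _ h
    have hsub : σ ⊆ W := by
      intro v hv
      by_cases hvx : v = x
      · exact hvx ▸ hx
      · exact h1 (Finset.mem_erase.2 ⟨hvx, hv⟩)
    refine ⟨hsub, ?_, ?_⟩
    · intro a ha b hb hab
      simp only [Finset.mem_coe] at ha hb
      by_cases hax : a = x
      · subst hax; exact hiso b (hsub hb)
      by_cases hbx : b = x
      · subst hbx; exact fun h => hiso a (hsub ha) h.symm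
      · exact h2 (by simp [hax, ha]) (by simp [hbx, hb]) hab
    · rw [← h3, Finset.card_erase_add_one hxσ]
  · funext σ
    simp only [bdry]
    by_cases hxσ : x ∈ σ
    · have key : ∀ v ∈ σᶜ, (if x ∈ insert v σ then z ((insert v σ).erase x) else 0)
          = z (insert v (σ.erase x)) := by
        intro v hv
        have hvx : v ≠ x := by rintro rfl; simp_all
        rw [if_pos (Finset.mem_insert_of_mem hxσ), Finset.erase_insert_of_ne hvx]
      rw [Finset.sum_congr rfl key]
      have h0 := congrFun hzc (σ.erase x)
      simp only [bdry, Pi.zero_apply] at h0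
      rw [Finset.compl_erase, Finset.sum_insert (by simp [hxσ]), Finset.insert_erase hxσ] at h0
      exact (CharTwo.add_eq_zero.1 h0).symm
    · rw [Finset.sum_eq_single x]
      · simp [Finset.erase_insert hxσ]
      · intro v hv hvx
        rw [if_neg]
        simp [hxσ, Ne.symm hvx]
      · intro h; simp [hxσ] at h

/-- Deleting the edge xy adds only the simplices {x, y} ∪ τ with τ independent in the exploded
graph. So a filling after deletion can be pushed off the new simplices, provided that its trace on
the exploded graph bounds. This is the relevant part of a Mayer–Vietoris sequence, done by hand on
chains. -/
theorem fills_of_explosion {H : SimpleGraph V} {W : Finset V} {x y : V} (hx : x ∈ W) (hy : y ∈ W)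
    (hxy : H.Adj x y) {j : ℕ} (hdel : Fills (H.deleteEdges {s(x, y)}) W j)
    (hexp : ∀ i, i + 1 = j → Fills H (W \ (nbr H W x ∪ nbr H W y)) i) : Fills H W j := by
  have hne : x ≠ y := hxy.ne
  set H' := H.deleteEdges {s(x, y)} with hH'
  have hadj : ∀ a b, H.Adj a b → ¬ H'.Adj a b → (a = x ∧ b = y) ∨ (a = y ∧ b = x) := by
    intro a b h1 h2
    simp only [hH', SimpleGraph.deleteEdges_adj, not_and, not_not, Set.mem_singleton_iff] at h2
    simpa using h2 h1
  have hindep : ∀ σ : Finset V, H'.IsIndepSet (σ : Set V) → ¬ (x ∈ σ ∧ y ∈ σ) →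
      H.IsIndepSet (σ : Set V) := by
    intro σ h1 h2 a ha b hb hab h
    rcases hadj a b h (h1 ha hb hab) with ⟨rfl, rfl⟩ | ⟨rfl, rfl⟩
    · exact h2 ⟨ha, hb⟩
    · exact h2 ⟨hb, ha⟩
  intro z hz hzc
  obtain ⟨c, hc, hcz⟩ := hdel z (fun σ hσ => by
    obtain ⟨h1, h2, h3⟩ := hz σ hσ
    exact ⟨h1, fun a ha b hb hab h => h2 ha hb hab (SimpleGraph.deleteEdges_le _ h), h3⟩) hzc
  rcases Nat.eq_zero_or_eq_succ_pred j with rfl | hj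
  · refine ⟨c, fun σ hσ => ?_, hcz⟩
    obtain ⟨h1, h2, h3⟩ := hc σ hσ
    refine ⟨h1, hindep σ h2 ?_, h3⟩
    rintro ⟨ha, hb⟩
    have : 1 < σ.card := Finset.one_lt_card.2 ⟨x, ha, y, hb, hne⟩
    omega
  obtain ⟨i, rfl⟩ : ∃ i, j = i + 1 := ⟨_, hj⟩
  set W' := W \ (nbr H W x ∪ nbr H W y) with hW'
  have hmW' : ∀ v, v ∈ W' ↔ v ∈ W ∧ ¬ H.Adj x v ∧ ¬ H.Adj y v := by
    intro v; simp only [hW', Finset.mem_sdiff, Finset.mem_union, mem_nbr]; tauto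
  have hxW' : x ∉ W' := fun h => ((hmW' x).1 h).2.2 hxy.symm
  have hyW' : y ∉ W' := fun h => ((hmW' y).1 h).2.1 hxy
  -- The forbidden part of the filling, with x and y stripped off. It is a cycle because z vanishes
  -- on sets containing both x and y.
  let c1 : Finset V → ZMod 2 := fun τ => if x ∉ τ ∧ y ∉ τ then c (insert x (insert y τ)) else 0
  have hc1 : IndepChain H W' i c1 := by
    intro τ hτ
    simp only [c1, ne_eq, ite_eq_right_iff, Classical.not_imp] at hτ
    obtain ⟨⟨hxτ, hyτ⟩, h⟩ := hτ
    obtain ⟨h1, h2, h3⟩ := hc _ h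
    have hstep : ∀ v ∈ τ, ¬ H.Adj x v ∧ ¬ H.Adj y v := by
      intro v hv
      have hvx : v ≠ x := by rintro rfl; exact hxτ hv
      have hvy : v ≠ y := by rintro rfl; exact hyτ hv
      constructor
      · intro h
        rcases hadj x v h (h2 (by simp) (by simp [hv]) hvx.symm) with h | h
        · exact hvy h.2
        · exact hvx h.2
      · intro h
        rcases hadj y v h (h2 (by simp) (by simp [hv]) hvy.symm) with h | h
        · exact hvy h.2
        · exact hvx h.2
    refine ⟨fun v hv => (hmW' v).2 ⟨h1 (by simp [hv]), hstep v hv⟩, ?_, ?_⟩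
    · apply hindep _ _ (fun h => hxτ h.1)
      exact h2.mono (by intro v hv; simp at hv; simp [hv])
    · rw [Finset.card_insert_of_notMem (by simp [hne, hxτ]), Finset.card_insert_of_notMem hyτ] at h3
      omega
  have hc1c : bdry c1 = 0 := by
    funext τ
    simp only [bdry, Pi.zero_apply]
    by_cases hτ : x ∉ τ ∧ y ∉ τ
    · have hz0 : z (insert x (insert y τ)) = 0 := by
        by_contra h
        exact (hz _ h).2.1 (by simp) (by simp) hne hxy
      rw [← hcz, bdry] at hz0
      have hcompl : τᶜ = insert x (insert y (insert x (insert y τ))ᶜ) := by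
        ext v; simp only [Finset.mem_compl, Finset.mem_insert]
        grind
      rw [hcompl, Finset.sum_insert (by simp [hne]), Finset.sum_insert (by simp)]
      have h1 : c1 (insert x τ) = 0 := by simp [c1]
      have h2 : c1 (insert y τ) = 0 := by simp [c1]
      rw [h1, h2, zero_add, zero_add, ← hz0]
      refine Finset.sum_congr rfl fun v hv => ?_
      simp only [Finset.mem_compl, Finset.mem_insert, not_or] at hv
      have : x ∉ insert v τ ∧ y ∉ insert v τ := by
        simp [hτ.1, hτ.2, Ne.symm hv.1, Ne.symm hv.2.1]
      simp only [c1, if_pos this]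
      congr 1
      ext w; simp only [Finset.mem_insert]; tauto
    · refine Finset.sum_eq_zero fun v _ => ?_
      simp only [c1]
      rw [if_neg]
      simp only [Finset.mem_insert, not_or]
      tauto
  obtain ⟨c2, hc2, hc21⟩ := hexp i rfl c1 hc1 hc1c
  have hc2x : ∀ σ, x ∈ σ → c2 σ = 0 := fun σ h => by
    by_contra h'; exact hxW' ((hc2 σ h').1 h)
  have hc2y : ∀ σ, y ∈ σ → c2 σ = 0 := fun σ h => by
    by_contra h'; exact hyW' ((hc2 σ h').1 h)
  -- The join of {x, y} with the filling of `c1`. Adding its boundary keeps the boundary of `c`,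
  -- cancels the forbidden part, and otherwise adds only sets with one of x, y.
  let e : Finset V → ZMod 2 := fun σ => if x ∈ σ ∧ y ∈ σ then c2 ((σ.erase x).erase y) else 0
  have hins : ∀ (σ τ : Finset V) (a b : V), a ∈ σ → b ∉ σ → a ≠ b →
      (∀ v, v ∈ τ ↔ v ∈ σ ∧ v ≠ a) → (a = x ∧ b = y ∨ a = y ∧ b = x) →
      (c + bdry e) σ ≠ 0 → σ ⊆ W ∧ H.IsIndepSet (σ : Set V) ∧ σ.card = i + 1 + 1 := by
    intro σ τ a b ha hb hab hτ hor h
    have hbd : bdry e σ = c2 τ := by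
      simp only [bdry]
      rw [Finset.sum_eq_single b]
      · simp only [e]
        rw [if_pos]
        · congr 1
          ext v
          simp only [Finset.mem_erase, Finset.mem_insert, hτ]
          rcases hor with ⟨rfl, rfl⟩ | ⟨rfl, rfl⟩
          · by_cases hvy : v = b
            · subst hvy; simp [hb]
            · simp [hvy, and_comm]
          · by_cases hvy : v = b
            · subst hvy; simp [hb]
            · simp [hvy, and_comm]
        · rcases hor with ⟨rfl, rfl⟩ | ⟨rfl, rfl⟩ <;> simp [ha]
      · intro v hv hvb
        simp only [e]
        rw [if_neg]
        simp only [Finset.mem_compl] at hv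
        rcases hor with ⟨rfl, rfl⟩ | ⟨rfl, rfl⟩ <;> simp [hb, Ne.symm hvb]
      · intro h; simp [hb] at h
    have haW : a ∈ W ∧ ∀ v ∈ W', ¬ H.Adj a v := by
      rcases hor with ⟨rfl, rfl⟩ | ⟨rfl, rfl⟩
      · exact ⟨hx, fun v hv => ((hmW' v).1 hv).2.1⟩
      · exact ⟨hy, fun v hv => ((hmW' v).1 hv).2.2⟩
    simp only [Pi.add_apply, hbd] at h
    by_cases hcs : c σ = 0
    · rw [hcs, zero_add] at h
      obtain ⟨h1, h2, h3⟩ := hc2 τ h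
      have hσ : σ = insert a τ := by
        ext v; simp only [Finset.mem_insert, hτ]
        by_cases hva : v = a
        · subst hva; simp [ha]
        · simp [hva]
      have haτ : a ∉ τ := by simp [hτ]
      refine ⟨?_, ?_, ?_⟩
      · rw [hσ]
        exact Finset.insert_subset haW.1 (h1.trans Finset.sdiff_subset)
      · rw [hσ, Finset.coe_insert]
        intro u hu v hv huv hadj'
        rcases hu with rfl | hu <;> rcases hv with rfl | hv
        · exact huv rfl
        · exact haW.2 v (h1 hv) hadj'
        · exact haW.2 u (h1 hu) hadj'.symm
        · exact h2 hu hv huv hadj'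
      · rw [hσ, Finset.card_insert_of_notMem haτ, h3]
    · obtain ⟨h1, h2, h3⟩ := hc σ hcs
      refine ⟨h1, hindep σ h2 ?_, h3⟩
      rcases hor with ⟨rfl, rfl⟩ | ⟨rfl, rfl⟩ <;> tauto
  refine ⟨c + bdry e, ?_, by rw [bdry_add, bdry_bdry, add_zero, hcz]⟩
  intro σ hσ
  by_cases hxσ : x ∈ σ <;> by_cases hyσ : y ∈ σ
  · exfalso
    apply hσ
    have hτx : x ∉ (σ.erase x).erase y := by simp
    have hτy : y ∉ (σ.erase x).erase y := by simp
    set τ := (σ.erase x).erase y with hτ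
    have hσ' : insert x (insert y τ) = σ := by
      ext v; simp only [hτ, Finset.mem_insert, Finset.mem_erase]
      grind
    have h1 : bdry e σ = bdry c2 τ := by
      have hcompl : τᶜ = insert x (insert y σᶜ) := by
        ext v; simp only [hτ, Finset.mem_compl, Finset.mem_insert, Finset.mem_erase]
        grind
      simp only [bdry]
      rw [hcompl, Finset.sum_insert (by simp [hne, hxσ]), Finset.sum_insert (by simp [hyσ]),
        hc2x _ (by simp), hc2y _ (by simp), zero_add, zero_add]
      refine Finset.sum_congr rfl fun v hv => ?_
      simp only [Finset.mem_compl] at hv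
      have hvx : v ≠ x := by rintro rfl; exact hv hxσ
      have hvy : v ≠ y := by rintro rfl; exact hv hyσ
      simp only [e]
      rw [if_pos (by simp [hxσ, hyσ]), Finset.erase_insert_of_ne hvx,
        Finset.erase_insert_of_ne hvy]
    rw [Pi.add_apply, h1, hc21]
    simp only [c1]
    rw [if_pos ⟨hτx, hτy⟩, hσ']
    exact CharTwo.add_self_eq_zero _
  · exact hins σ (σ.erase x) x y hxσ hyσ hne (by intro v; simp [and_comm]) (Or.inl ⟨rfl, rfl⟩) hσ
  · exact hins σ (σ.erase y) y x hyσ hxσ hne.symm (by intro v; simp [and_comm])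
      (Or.inr ⟨rfl, rfl⟩) hσ
  · have h1 : bdry e σ = 0 := by
      simp only [bdry]
      refine Finset.sum_eq_zero fun v _ => ?_
      simp only [e]
      rw [if_neg]
      rintro ⟨h1, h2⟩
      simp only [Finset.mem_insert, hxσ, hyσ, or_false] at h1 h2
      exact hne (h1.trans h2.symm)
    rw [Pi.add_apply, h1, add_zero] at hσ
    obtain ⟨a1, a2, a3⟩ := hc σ hσ
    exact ⟨a1, hindep σ a2 (fun h => hxσ h.1), a3⟩

end Chains


/-! ### The size bound from explosions, and its near-extremal graphs -/

section ExactGraphs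

variable {V : Type*} [Fintype V] [DecidableEq V]

theorem NonFilling.explosion {H : SimpleGraph V} {W : Finset V} {k : ℕ} (h : NonFilling H W k)
    {x y : V} (hx : x ∈ W) (hy : y ∈ W) (hxy : H.Adj x y)
    (hdel : ¬ NonFilling (H.deleteEdges {s(x, y)}) W k) :
    ∃ l, k = l + 1 ∧ NonFilling H (W \ (nbr H W x ∪ nbr H W y)) l := by
  obtain ⟨j, hj, hf⟩ := h
  have hd : Fills (H.deleteEdges {s(x, y)}) W j := by
    by_contra hd
    exact hdel ⟨j, hj, hd⟩
  by_contra hcon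
  refine hf (fills_of_explosion hx hy hxy hd fun i hi => ?_)
  by_contra hfi
  exact hcon ⟨k - 1, by omega, i, by omega, hfi⟩

theorem exists_edge_minimal (P : SimpleGraph V → Prop) {H : SimpleGraph V} (h : P H) :
    ∃ H₀ ≤ H, P H₀ ∧ ∀ x y, H₀.Adj x y → ¬ P (H₀.deleteEdges {s(x, y)}) := by
  obtain ⟨H₀, hle, hmin⟩ := exists_minimal_le_of_wellFoundedLT P H h
  refine ⟨H₀, hle, hmin.prop, fun x y hxy hP => ?_⟩
  have := hmin.le_of_le hP (SimpleGraph.deleteEdges_le _) hxy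
  simp at this

theorem nbr_mono {H₀ H : SimpleGraph V} (hH : H₀ ≤ H) {W₀ W : Finset V} (hW : W₀ ⊆ W) (v : V) :
    nbr H₀ W₀ v ⊆ nbr H W v := by
  intro w hw
  rw [mem_nbr] at hw ⊢
  exact ⟨hW hw.1, hH hw.2⟩

theorem card_nbr_le_of_le {H₀ H : SimpleGraph V} (hH : H₀ ≤ H) {W₀ W : Finset V} (hW : W₀ ⊆ W)
    {Δ : ℕ} (hdeg : ∀ v ∈ W, (nbr H W v).card ≤ Δ) : ∀ v ∈ W₀, (nbr H₀ W₀ v).card ≤ Δ :=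
  fun v hv => (Finset.card_le_card (nbr_mono hH hW v)).trans (hdeg v (hW hv))

theorem card_sdiff_explosion {H : SimpleGraph V} {W : Finset V} {Δ : ℕ}
    (hdeg : ∀ v ∈ W, (nbr H W v).card ≤ Δ) {x y : V} (hx : x ∈ W) (hy : y ∈ W) :
    (W \ (nbr H W x ∪ nbr H W y)).card + (nbr H W x ∪ nbr H W y).card = W.card ∧
      (nbr H W x ∪ nbr H W y).card ≤ 2 * Δ := by
  constructor
  · apply Finset.card_sdiff_add_card_eq_card
    intro v hv
    rw [Finset.mem_union, mem_nbr, mem_nbr] at hv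
    tauto
  · have := Finset.card_union_le (nbr H W x) (nbr H W y)
    have := hdeg x hx
    have := hdeg y hy
    omega

theorem NonFilling.exists_edge {H : SimpleGraph V} {W : Finset V} {k : ℕ} (h : NonFilling H W k)
    (hW : W.Nonempty) : ∃ x ∈ W, ∃ y ∈ W, H.Adj x y := by
  obtain ⟨x, hx⟩ := hW
  by_contra hcon
  push Not at hcon
  obtain ⟨j, _, hf⟩ := h
  exact hf (fills_of_isolated hx (fun w hw => hcon x hx w hw) j)

/-- In an edge-minimal spanning subgraph with nonvanishing homology, every explosion keeps the
homology and lowers k by one, at the price of at most 2Δ vertices. An edge exists while vertices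
remain, since an isolated vertex would make the complex a cone. -/
theorem NonFilling.card_le {Δ k : ℕ} : ∀ {H : SimpleGraph V} {W : Finset V},
    NonFilling H W k → (∀ v ∈ W, (nbr H W v).card ≤ Δ) → W.card ≤ 2 * Δ * k := by
  induction k with
  | zero =>
    intro H W h hdeg
    obtain ⟨H₀, hle, hH₀, hmin⟩ := exists_edge_minimal (fun H => NonFilling H W 0) h
    rcases W.eq_empty_or_nonempty with rfl | hW
    · simp
    obtain ⟨x, hx, y, hy, hxy⟩ := hH₀.exists_edge hW
    obtain ⟨l, hl, -⟩ := hH₀.explosion hx hy hxy (hmin x y hxy)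
    omega
  | succ k ih =>
    intro H W h hdeg
    obtain ⟨H₀, hle, hH₀, hmin⟩ := exists_edge_minimal (fun H => NonFilling H W (k + 1)) h
    rcases W.eq_empty_or_nonempty with rfl | hW
    · simp
    obtain ⟨x, hx, y, hy, hxy⟩ := hH₀.exists_edge hW
    obtain ⟨l, hl, hl'⟩ := hH₀.explosion hx hy hxy (hmin x y hxy)
    obtain rfl : k = l := by omega
    have h1 := ih hl' (card_nbr_le_of_le hle Finset.sdiff_subset hdeg)
    have h2 := card_sdiff_explosion (card_nbr_le_of_le hle subset_rfl hdeg) hx hy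
    have : 2 * Δ * (k + 1) = 2 * Δ * k + 2 * Δ := by ring
    omega

/-- The vertices of `W` in the class `i` and on the side `b`. -/
def classSide (W : Finset V) (cl : V → ℕ) (sd : V → Bool) (i : ℕ) (b : Bool) : Finset V :=
  W.filter fun v => cl v = i ∧ sd v = b

/-- `cl` and `sd` exhibit a spanning subgraph of `H[W]` that is the disjoint union of `k` complete
bipartite graphs with nonempty sides. -/
structure BicliqueCover (H : SimpleGraph V) (W : Finset V) (k : ℕ) (cl : V → ℕ) (sd : V → Bool) :
    Prop where
  lt : ∀ v ∈ W, cl v < k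
  nonempty : ∀ i < k, ∀ b, (classSide W cl sd i b).Nonempty
  adj : ∀ u ∈ W, ∀ v ∈ W, cl u = cl v → sd u ≠ sd v → H.Adj u v

variable {H : SimpleGraph V} {W : Finset V} {k Δ : ℕ} {cl : V → ℕ} {sd : V → Bool}

theorem mem_classSide {i : ℕ} {b : Bool} {v : V} :
    v ∈ classSide W cl sd i b ↔ v ∈ W ∧ cl v = i ∧ sd v = b := by
  simp [classSide]

namespace BicliqueCover

theorem card_classSide_le (h : BicliqueCover H W k cl sd)
    (hdeg : ∀ v ∈ W, (nbr H W v).card ≤ Δ) {i : ℕ} (hi : i < k) (b : Bool) :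
    (classSide W cl sd i b).card ≤ Δ := by
  obtain ⟨v, hv⟩ := h.nonempty i hi (!b)
  rw [mem_classSide] at hv
  refine (Finset.card_le_card fun u hu => ?_).trans (hdeg v hv.1)
  rw [mem_classSide] at hu
  rw [mem_nbr]
  exact ⟨hu.1, h.adj v hv.1 u hu.1 (hv.2.1.trans hu.2.1.symm) (by rw [hv.2.2, hu.2.2]; simp)⟩

theorem card_class (W : Finset V) (cl : V → ℕ) (sd : V → Bool) (i : ℕ) :
    (W.filter fun v => cl v = i).card =
      (classSide W cl sd i true).card + (classSide W cl sd i false).card := by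
  rw [← Finset.card_union_of_disjoint]
  · congr 1
    ext v
    simp only [Finset.mem_filter, Finset.mem_union, mem_classSide]
    cases sd v <;> simp
  · rw [Finset.disjoint_left]
    intro v h1 h2
    rw [mem_classSide] at h1 h2
    simp [h1.2.2] at h2

theorem card_class_le (h : BicliqueCover H W k cl sd)
    (hdeg : ∀ v ∈ W, (nbr H W v).card ≤ Δ) {i : ℕ} (hi : i < k) :
    (W.filter fun v => cl v = i).card ≤ 2 * Δ := by
  rw [card_class W cl sd]
  have := h.card_classSide_le hdeg hi true
  have := h.card_classSide_le hdeg hi false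
  omega

theorem card_filter_le (h : BicliqueCover H W k cl sd)
    (hdeg : ∀ v ∈ W, (nbr H W v).card ≤ Δ) {I : Finset ℕ} (hI : I ⊆ Finset.range k) :
    (W.filter fun v => cl v ∈ I).card ≤ 2 * Δ * I.card := by
  refine Finset.card_le_mul_card_image_of_maps_to (f := cl) (t := I)
    (fun v hv => (Finset.mem_filter.1 hv).2) _ fun i hi => ?_
  rw [Finset.filter_filter]
  refine (Finset.card_le_card ?_).trans (h.card_class_le hdeg (Finset.mem_range.1 (hI hi)))
  intro v hv
  simp only [Finset.mem_filter] at hv ⊢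
  exact ⟨hv.1, hv.2.2⟩

theorem card_le (h : BicliqueCover H W k cl sd)
    (hdeg : ∀ v ∈ W, (nbr H W v).card ≤ Δ) : W.card ≤ 2 * Δ * k := by
  have h1 := h.card_filter_le hdeg (subset_refl (Finset.range k))
  rw [Finset.filter_true_of_mem fun v hv => Finset.mem_range.2 (h.lt v hv),
    Finset.card_range] at h1
  exact h1

/-- The total falls short of 2Δk by less than Δ/2 and each class has at most 2Δ vertices, so no
class can lack Δ/2 of them. -/
theorem card_class_gt (h : BicliqueCover H W k cl sd)
    (hdeg : ∀ v ∈ W, (nbr H W v).card ≤ Δ) (hc : 4 * Δ * k < 2 * W.card + Δ)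
    {i : ℕ} (hi : i < k) : 3 * Δ < 2 * (W.filter fun v => cl v = i).card := by
  have h1 := h.card_filter_le hdeg (Finset.erase_subset i (Finset.range k))
  rw [Finset.card_erase_of_mem (Finset.mem_range.2 hi), Finset.card_range] at h1
  have h2 : (W.filter fun v => cl v = i).card +
      (W.filter fun v => cl v ∈ (Finset.range k).erase i).card = W.card := by
    rw [← Finset.card_filter_add_card_filter_not (s := W) (fun v => cl v = i)]
    congr 2
    refine Finset.filter_congr fun v hv => ?_
    simp [h.lt v hv]
  obtain ⟨m, rfl⟩ : ∃ m, k = m + 1 := ⟨k - 1, by omega⟩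
  simp only [Nat.add_sub_cancel] at h1
  have : 4 * Δ * (m + 1) = 2 * (2 * Δ * m) + 4 * Δ := by ring
  omega

/-- The two sides of the biclique through a given vertex. -/
theorem exists_sides (h : BicliqueCover H W k cl sd)
    (hdeg : ∀ v ∈ W, (nbr H W v).card ≤ Δ) (hc : 4 * Δ * k < 2 * W.card + Δ) {w : V}
    (hw : w ∈ W) : ∃ A B : Finset V, A ⊆ W ∧ B ⊆ W ∧ w ∈ A ∧ Disjoint A B ∧
      (∀ a ∈ A, ∀ b ∈ B, H.Adj a b) ∧ Δ < 2 * A.card ∧ Δ < 2 * B.card ∧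
      3 * Δ < 2 * (A.card + B.card) := by
  have hk := h.lt w hw
  have h1 := h.card_class_gt hdeg hc hk
  rw [card_class W cl sd] at h1
  have h2 := h.card_classSide_le hdeg hk (sd w)
  have h3 := h.card_classSide_le hdeg hk (!sd w)
  have h4 : 3 * Δ < 2 * ((classSide W cl sd (cl w) (sd w)).card +
      (classSide W cl sd (cl w) (!sd w)).card) := by
    cases hb : sd w
    · simp only [Bool.not_false]; omega
    · simp only [Bool.not_true]; omega
  refine ⟨classSide W cl sd (cl w) (sd w), classSide W cl sd (cl w) (!sd w),
    Finset.filter_subset _ _, Finset.filter_subset _ _, mem_classSide.2 ⟨hw, rfl, rfl⟩,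
    ?_, ?_, by omega, by omega, h4⟩
  · rw [Finset.disjoint_left]
    intro v h1 h2
    rw [mem_classSide] at h1 h2
    simp [h1.2.2] at h2
  · intro a ha b hb
    rw [mem_classSide] at ha hb
    exact h.adj a ha.1 b hb.1 (ha.2.1.trans hb.2.1.symm) (by rw [ha.2.2, hb.2.2]; simp)

end BicliqueCover

/-- Every explosion of an edge inside `W` leaves a graph covered by `k` bicliques. -/
structure ExplodesToBicliques (H : SimpleGraph V) (W : Finset V) (Δ k : ℕ) : Prop where
  deg : ∀ v ∈ W, (nbr H W v).card ≤ Δ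
  count : 4 * Δ * (k + 1) < 2 * W.card + Δ
  cover : ∀ x ∈ W, ∀ y ∈ W, H.Adj x y →
    ∃ cl sd, BicliqueCover H (W \ (nbr H W x ∪ nbr H W y)) k cl sd

namespace ExplodesToBicliques

theorem exists_sides (h : ExplodesToBicliques H W Δ k) {x y w : V} (hx : x ∈ W) (hy : y ∈ W)
    (hxy : H.Adj x y) (hw : w ∈ W) (hwx : ¬ H.Adj x w) (hwy : ¬ H.Adj y w) :
    ∃ A B : Finset V, (∀ v ∈ A, v ∈ W ∧ ¬ H.Adj x v ∧ ¬ H.Adj y v) ∧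
      (∀ v ∈ B, v ∈ W ∧ ¬ H.Adj x v ∧ ¬ H.Adj y v) ∧ w ∈ A ∧ Disjoint A B ∧
      (∀ a ∈ A, ∀ b ∈ B, H.Adj a b) ∧ Δ < 2 * A.card ∧ Δ < 2 * B.card ∧
      3 * Δ < 2 * (A.card + B.card) := by
  obtain ⟨cl, sd, hcov⟩ := h.cover x hx y hy hxy
  have hm : ∀ v, v ∈ W \ (nbr H W x ∪ nbr H W y) ↔ v ∈ W ∧ ¬ H.Adj x v ∧ ¬ H.Adj y v := by
    intro v; simp only [Finset.mem_sdiff, Finset.mem_union, mem_nbr]; tauto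
  have hcard := card_sdiff_explosion h.deg hx hy
  have hcnt := h.count
  have : 4 * Δ * (k + 1) = 4 * Δ * k + 4 * Δ := by ring
  obtain ⟨A, B, hA, hB, h1⟩ := hcov.exists_sides
    (card_nbr_le_of_le le_rfl Finset.sdiff_subset h.deg) (by omega) ((hm w).2 ⟨hw, hwx, hwy⟩)
  exact ⟨A, B, fun v hv => (hm v).1 (hA hv), fun v hv => (hm v).1 (hB hv), h1⟩

theorem card_union_le_deg (h : ExplodesToBicliques H W Δ k) {u : V} (hu : u ∈ W) {S T : Finset V}
    (hS : ∀ v ∈ S, v ∈ W ∧ H.Adj u v) (hT : ∀ v ∈ T, v ∈ W ∧ H.Adj u v) (hST : Disjoint S T) :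
    S.card + T.card ≤ Δ := by
  rw [← Finset.card_union_of_disjoint hST]
  refine (Finset.card_le_card fun v hv => ?_).trans (h.deg u hu)
  rw [mem_nbr]
  rcases Finset.mem_union.1 hv with hv | hv
  · exact hS v hv
  · exact hT v hv

/-- If a and w were adjacent, comparing the biclique of w after exploding xy with the bicliques left
by exploding aw and xa would give some vertex more than Δ neighbours. -/
theorem not_adj_of_adj_left (h : ExplodesToBicliques H W Δ k) {x y a w : V} (hx : x ∈ W)
    (hy : y ∈ W) (hxy : H.Adj x y) (ha : a ∈ W) (hxa : H.Adj x a) (hw : w ∈ W)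
    (hwx : ¬ H.Adj x w) (hwy : ¬ H.Adj y w) : ¬ H.Adj a w := by
  intro haw
  obtain ⟨A, B, hA, hB, hwA, hdisj, hcomp, hcA, hcB, hcAB⟩ := h.exists_sides hx hy hxy hw hwx hwy
  -- Otherwise u survives the explosion of aw and has more than Δ/2 neighbours outside N(w), besides
  -- the more than Δ/2 in B ⊆ N(w).
  have hAaw : ∀ u ∈ A, ¬ H.Adj a u → H.Adj w u := by
    intro u hu hau
    by_contra hwu
    obtain ⟨A', B', hA', hB', huA', -, hcomp', -, hcB', -⟩ :=
      h.exists_sides ha hw haw (hA u hu).1 hau hwu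
    have := h.card_union_le_deg (hA u hu).1 (S := B) (T := B')
      (fun v hv => ⟨(hB v hv).1, hcomp u hu v hv⟩)
      (fun v hv => ⟨(hB' v hv).1, hcomp' u huA' v hv⟩)
      (Finset.disjoint_left.2 fun v hv hv' => (hB' v hv').2.2 (hcomp w hwA v hv))
    omega
  -- Here u survives the explosion of xa, so more than Δ/2 of its neighbours avoid N(a).
  have hkey : ∀ (P : Finset V) (u : V), (∀ v ∈ P, v ∈ W ∧ H.Adj u v) → u ∈ W → ¬ H.Adj x u →
      ¬ H.Adj a u → 2 * (P ∩ nbr H W a).card < Δ := by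
    intro P u hP hu hxu hau
    obtain ⟨A', B', hA', hB', huA', -, hcomp', -, hcB', -⟩ := h.exists_sides hx ha hxa hu hxu hau
    have := h.card_union_le_deg hu (S := P ∩ nbr H W a) (T := B')
      (fun v hv => hP v (Finset.mem_inter.1 hv).1)
      (fun v hv => ⟨(hB' v hv).1, hcomp' u huA' v hv⟩)
      (Finset.disjoint_left.2 fun v hv hv' =>
        (hB' v hv').2.2 (mem_nbr.1 (Finset.mem_inter.1 hv).2).2)
    omega
  by_cases hBa : ∀ u ∈ B, H.Adj a u
  · by_cases hAa : ∀ u ∈ A, H.Adj a u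
    · have := h.card_union_le_deg ha (S := A) (T := B)
        (fun v hv => ⟨(hA v hv).1, hAa v hv⟩) (fun v hv => ⟨(hB v hv).1, hBa v hv⟩) hdisj
      omega
    · push Not at hAa
      obtain ⟨u, hu, hau⟩ := hAa
      have h1 := hkey B u (fun v hv => ⟨(hB v hv).1, hcomp u hu v hv⟩) (hA u hu).1
        (hA u hu).2.1 hau
      rw [Finset.inter_eq_left.2 fun v hv => mem_nbr.2 ⟨(hB v hv).1, hBa v hv⟩] at h1
      omega
  · push Not at hBa
    obtain ⟨u, hu, hau⟩ := hBa
    have h1 := hkey A u (fun v hv => ⟨(hA v hv).1, (hcomp v hv u hu).symm⟩) (hB u hu).1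
      (hB u hu).2.1 hau
    have h2 := h.card_union_le_deg hw (S := A \ nbr H W a) (T := B)
      (fun v hv => by
        have hv' := Finset.mem_sdiff.1 hv
        exact ⟨(hA v hv'.1).1, hAaw v hv'.1 fun hav => hv'.2 (mem_nbr.2 ⟨(hA v hv'.1).1, hav⟩)⟩)
      (fun v hv => ⟨(hB v hv).1, hcomp w hwA v hv⟩)
      (hdisj.mono_left Finset.sdiff_subset)
    have h3 := Finset.card_inter_add_card_sdiff A (nbr H W a)
    omega

/-- The exploded set of an edge is a union of connected components. -/
theorem not_adj (h : ExplodesToBicliques H W Δ k) {x y a w : V} (hx : x ∈ W)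
    (hy : y ∈ W) (hxy : H.Adj x y) (ha : a ∈ nbr H W x ∪ nbr H W y) (hw : w ∈ W)
    (hwD : w ∉ nbr H W x ∪ nbr H W y) : ¬ H.Adj a w := by
  simp only [Finset.mem_union, mem_nbr, not_or, not_and] at ha hwD
  rcases ha with ha | ha
  · exact h.not_adj_of_adj_left hx hy hxy ha.1 ha.2 hw (hwD.1 hw) (hwD.2 hw)
  · exact h.not_adj_of_adj_left hy hx hxy.symm ha.1 ha.2 hw (hwD.2 hw) (hwD.1 hw)

theorem card_explosion_gt (h : ExplodesToBicliques H W Δ k) {x y : V} (hx : x ∈ W)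
    (hy : y ∈ W) (hxy : H.Adj x y) : 3 * Δ < 2 * (nbr H W x ∪ nbr H W y).card := by
  obtain ⟨cl, sd, hcov⟩ := h.cover x hx y hy hxy
  have h1 := hcov.card_le (card_nbr_le_of_le le_rfl Finset.sdiff_subset h.deg)
  have h2 := card_sdiff_explosion h.deg hx hy
  have h3 := h.count
  have : 4 * Δ * (k + 1) = 2 * (2 * Δ * k) + 4 * Δ := by ring
  omega

/-- If a and b were not adjacent, b would survive the explosion of xa. Then N(x) ∪ N(a), with more
than 3Δ/2 vertices, and the opposite side of the biclique of b, with more than Δ/2, would be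
disjoint inside the closed set N(x) ∪ N(y), which has at most 2Δ. -/
theorem adj_of_mem (h : ExplodesToBicliques H W Δ k) {x y a b : V} (hx : x ∈ W)
    (hy : y ∈ W) (hxy : H.Adj x y) (ha : a ∈ nbr H W x) (hb : b ∈ nbr H W x ∪ nbr H W y)
    (hbx : ¬ H.Adj x b) : H.Adj a b := by
  by_contra hab
  have haD : a ∈ nbr H W x ∪ nbr H W y := Finset.mem_union_left _ ha
  have hxD : x ∈ nbr H W x ∪ nbr H W y :=
    Finset.mem_union_right _ (mem_nbr.2 ⟨hx, hxy.symm⟩)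
  rw [mem_nbr] at ha
  have hbW : b ∈ W := by
    rw [Finset.mem_union, mem_nbr, mem_nbr] at hb
    tauto
  obtain ⟨A, B, hA, hB, hbA, -, hcomp, -, hcB, -⟩ := h.exists_sides hx ha.1 ha.2 hbW hbx hab
  have hsub : (nbr H W x ∪ nbr H W a) ∪ B ⊆ nbr H W x ∪ nbr H W y := by
    have hcl : ∀ p ∈ nbr H W x ∪ nbr H W y, ∀ v ∈ W, H.Adj p v → v ∈ nbr H W x ∪ nbr H W y := by
      intro p hp v hv hpv
      by_contra hvD
      exact h.not_adj hx hy hxy hp hv hvD hpv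
    intro v hv
    simp only [Finset.mem_union, mem_nbr] at hv
    rcases hv with (hv | hv) | hv
    · exact hcl x hxD v hv.1 hv.2
    · exact hcl a haD v hv.1 hv.2
    · exact hcl b hb v (hB v hv).1 (hcomp b hbA v hv)
  have h1 := Finset.card_le_card hsub
  rw [Finset.card_union_of_disjoint] at h1
  · have h2 := (card_sdiff_explosion h.deg hx hy).2
    have h3 := h.card_explosion_gt hx ha.1 ha.2
    omega
  · rw [Finset.disjoint_left]
    intro v hv hvB
    simp only [Finset.mem_union, mem_nbr] at hv
    have := hB v hvB
    tauto

/-- The exploded set N(x) ∪ N(y) becomes the new class k, with sides N(x) and the rest. -/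
theorem exists_cover (h : ExplodesToBicliques H W Δ k) {x y : V} (hx : x ∈ W)
    (hy : y ∈ W) (hxy : H.Adj x y) : ∃ cl sd, BicliqueCover H W (k + 1) cl sd := by
  obtain ⟨cl, sd, hcov⟩ := h.cover x hx y hy hxy
  set D := nbr H W x ∪ nbr H W y with hD
  have hDW : D ⊆ W := by
    intro v hv
    rw [hD, Finset.mem_union, mem_nbr, mem_nbr] at hv
    tauto
  classical
  refine ⟨fun v => if v ∈ D then k else cl v, fun v => if v ∈ D then decide (H.Adj x v) else sd v,
    ?_, ?_, ?_⟩
  · intro v hv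
    split_ifs with hvD
    · omega
    · exact (hcov.lt v (Finset.mem_sdiff.2 ⟨hv, hvD⟩)).trans (Nat.lt_succ_self k)
  · intro i hi b
    rcases Nat.lt_succ_iff_lt_or_eq.1 hi with hi | rfl
    · obtain ⟨v, hv⟩ := hcov.nonempty i hi b
      rw [mem_classSide, Finset.mem_sdiff] at hv
      exact ⟨v, mem_classSide.2 ⟨hv.1.1, by rw [if_neg hv.1.2]; exact hv.2.1,
        by rw [if_neg hv.1.2]; exact hv.2.2⟩⟩
    · have hxD : x ∈ D := Finset.mem_union_right _ (mem_nbr.2 ⟨hx, hxy.symm⟩)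
      have hyD : y ∈ D := Finset.mem_union_left _ (mem_nbr.2 ⟨hy, hxy⟩)
      cases b
      · exact ⟨x, mem_classSide.2 ⟨hx, by simp [hxD], by simp [hxD]⟩⟩
      · exact ⟨y, mem_classSide.2 ⟨hy, by simp [hyD], by simp [hyD, hxy]⟩⟩
  · intro u hu v hv hcl hsd
    by_cases huD : u ∈ D <;> by_cases hvD : v ∈ D
    · simp only [huD, hvD, if_true] at hsd
      by_cases hxu : H.Adj x u <;> by_cases hxv : H.Adj x v
      · simp [hxu, hxv] at hsd
      · exact h.adj_of_mem hx hy hxy (mem_nbr.2 ⟨hu, hxu⟩) hvD hxv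
      · exact (h.adj_of_mem hx hy hxy (mem_nbr.2 ⟨hv, hxv⟩) huD hxu).symm
      · simp [hxu, hxv] at hsd
    · simp only [huD, hvD, if_true, if_false] at hcl
      have := hcov.lt v (Finset.mem_sdiff.2 ⟨hv, hvD⟩)
      omega
    · simp only [huD, hvD, if_true, if_false] at hcl
      have := hcov.lt u (Finset.mem_sdiff.2 ⟨hu, huD⟩)
      omega
    · simp only [huD, hvD, if_false] at hcl hsd
      exact hcov.adj u (Finset.mem_sdiff.2 ⟨hu, huD⟩) v (Finset.mem_sdiff.2 ⟨hv, hvD⟩) hcl hsd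

/-- Adjacent vertices lie in the same class of a biclique cover. -/
theorem class_eq_of_adj (h : ExplodesToBicliques H W Δ k) (hcov : BicliqueCover H W (k + 1) cl sd)
    {x y : V} (hx : x ∈ W) (hy : y ∈ W) (hxy : H.Adj x y) : cl x = cl y := by
  by_contra hne
  have hcl : ∀ p ∈ nbr H W x ∪ nbr H W y, ∀ v ∈ W, H.Adj p v → v ∈ nbr H W x ∪ nbr H W y := by
    intro p hp v hv hpv
    by_contra hvD
    exact h.not_adj hx hy hxy hp hv hvD hpv
  have hcls : ∀ p ∈ nbr H W x ∪ nbr H W y, p ∈ W →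
      (W.filter fun v => cl v = cl p) ⊆ nbr H W x ∪ nbr H W y := by
    intro p hpD hp v hv
    rw [Finset.mem_filter] at hv
    obtain ⟨u, hu⟩ := hcov.nonempty (cl p) (hcov.lt p hp) (!sd p)
    rw [mem_classSide] at hu
    have huD := hcl p hpD u hu.1 (hcov.adj p hp u hu.1 hu.2.1.symm (by rw [hu.2.2]; simp))
    by_cases hs : sd v = sd p
    · exact hcl u huD v hv.1 (hcov.adj u hu.1 v hv.1 (hu.2.1.trans hv.2.symm)
        (by rw [hu.2.2, hs]; simp))
    · exact hcl p hpD v hv.1 (hcov.adj p hp v hv.1 hv.2.symm fun e => hs e.symm)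
  have h1 := hcls x (Finset.mem_union_right _ (mem_nbr.2 ⟨hx, hxy.symm⟩)) hx
  have h2 := hcls y (Finset.mem_union_left _ (mem_nbr.2 ⟨hy, hxy⟩)) hy
  -- Two whole classes, of more than 3Δ/2 vertices each, do not fit into an exploded set of at most
  -- 2Δ.
  have h3 := Finset.card_le_card (Finset.union_subset h1 h2)
  rw [Finset.card_union_of_disjoint] at h3
  · have h4 := hcov.card_class_gt h.deg h.count (hcov.lt x hx)
    have h5 := hcov.card_class_gt h.deg h.count (hcov.lt y hy)
    have h6 := (card_sdiff_explosion h.deg hx hy).2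
    omega
  · rw [Finset.disjoint_left]
    intro v hv hv'
    rw [Finset.mem_filter] at hv hv'
    exact hne (hv.2.symm.trans hv'.2)

end ExplodesToBicliques

theorem BicliqueCover.mono {H₀ : SimpleGraph V} (h : BicliqueCover H₀ W k cl sd) (hle : H₀ ≤ H) :
    BicliqueCover H W k cl sd :=
  ⟨h.lt, h.nonempty, fun u hu v hv h1 h2 => hle (h.adj u hu v hv h1 h2)⟩

/-- If the homological bound on the size of `W` is nearly attained, then `H[W]` is covered by
bicliques. -/
theorem NonFilling.exists_cover : ∀ {H : SimpleGraph V} {W : Finset V}, NonFilling H W k →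
    (∀ v ∈ W, (nbr H W v).card ≤ Δ) → 4 * Δ * k < 2 * W.card + Δ →
    ∃ cl sd, BicliqueCover H W k cl sd := by
  induction k with
  | zero =>
    intro H W h hdeg hc
    have h1 := h.card_le hdeg
    obtain rfl : W = ∅ := by simpa using h1
    exact ⟨fun _ => 0, fun _ => true, by simp, by simp, by simp⟩
  | succ k ih =>
    intro H W h hdeg hc
    obtain ⟨H₀, hle, hH₀, hmin⟩ := exists_edge_minimal (fun H => NonFilling H W (k + 1)) h
    have hmul : 4 * Δ * (k + 1) = 4 * Δ * k + 4 * Δ := by ring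
    have hW : W.Nonempty := by
      by_contra hW
      rw [Finset.not_nonempty_iff_eq_empty] at hW
      subst hW
      simp only [Finset.card_empty] at hc
      omega
    have hdeg₀ := card_nbr_le_of_le hle subset_rfl hdeg
    obtain ⟨x, hx, y, hy, hxy⟩ := hH₀.exists_edge hW
    -- By minimality every edge of `H₀` can be exploded, and as at most 2Δ vertices are lost the
    -- near-extremal hypothesis passes to k.
    have hE : ExplodesToBicliques H₀ W Δ k := by
      refine ⟨hdeg₀, hc, fun x hx y hy hxy => ?_⟩
      obtain ⟨l, hl, hl'⟩ := hH₀.explosion hx hy hxy (hmin x y hxy)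
      obtain rfl : k = l := by omega
      have h2 := card_sdiff_explosion hdeg₀ hx hy
      exact ih hl' (card_nbr_le_of_le le_rfl Finset.sdiff_subset hdeg₀) (by omega)
    obtain ⟨cl, sd, hcov⟩ := hE.exists_cover hx hy hxy
    exact ⟨cl, sd, hcov.mono hle⟩

end ExactGraphs


/-! ### A topological Hall theorem by a Sperner argument -/

section Transversals

variable {V ι : Type*} [Fintype V] [DecidableEq V] [DecidableEq ι]

/-- `H[W]` has an independent transversal of the colours in `T`. -/
def FullIT (H : SimpleGraph V) (col : V → ι) (W : Finset V) (T : Finset ι) : Prop :=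
  ∃ J ⊆ W, H.IsIndepSet (J : Set V) ∧ Set.InjOn col (J : Set V) ∧ J.image col = T

/-- The vertices of `W` whose colour is in `S`. -/
def colored (col : V → ι) (W : Finset V) (S : Finset ι) : Finset V := W.filter fun v => col v ∈ S

theorem mem_colored {col : V → ι} {W : Finset V} {S : Finset ι} {v : V} :
    v ∈ colored col W S ↔ v ∈ W ∧ col v ∈ S := by
  simp [colored]

theorem colored_subset {col : V → ι} {W : Finset V} {S : Finset ι} : colored col W S ⊆ W :=
  Finset.filter_subset _ _

theorem colored_mono {col : V → ι} {W : Finset V} {S T : Finset ι} (h : S ⊆ T) :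
    colored col W S ⊆ colored col W T := fun v hv => by
  rw [mem_colored] at hv ⊢
  exact ⟨hv.1, h hv.2⟩

theorem IndepChain.mono {H : SimpleGraph V} {W W' : Finset V} (hW : W ⊆ W') {j : ℕ}
    {c : Finset V → ZMod 2} (h : IndepChain H W j c) : IndepChain H W' j c :=
  fun σ hσ => ⟨(h σ hσ).1.trans hW, (h σ hσ).2⟩

theorem IndepChain.sum {H : SimpleGraph V} {W : Finset V} {j : ℕ} {S : Finset ι}
    {c : ι → Finset V → ZMod 2} (h : ∀ p ∈ S, IndepChain H W j (c p)) :
    IndepChain H W j (fun σ => ∑ p ∈ S, c p σ) := by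
  intro σ hσ
  obtain ⟨p, hp, hpσ⟩ := Finset.exists_ne_zero_of_sum_ne_zero hσ
  exact h p hp σ hpσ

theorem bdry_sum {S : Finset ι} (c : ι → Finset V → ZMod 2) :
    bdry (fun σ => ∑ p ∈ S, c p σ) = fun σ => ∑ p ∈ S, bdry (c p) σ := by
  funext σ
  simp only [bdry]
  exact Finset.sum_comm

theorem sum_erase_erase {M : Type*} [AddCommMonoid M] (hM : ∀ a : M, a + a = 0) (S : Finset ι)
    (f : Finset ι → M) :
    ∑ p ∈ S, ∑ q ∈ S.erase p, f ((S.erase p).erase q) = 0 := by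
  rw [Finset.sum_sigma']
  refine Finset.sum_involution (fun p _ => ⟨p.2, p.1⟩) ?_ ?_ ?_ ?_
  · rintro ⟨p, q⟩ _
    simp only [Finset.erase_right_comm (a := q) (b := p)]
    exact hM _
  · rintro ⟨p, q⟩ h _ he
    simp only [Finset.mem_sigma, Finset.mem_erase, Sigma.mk.injEq] at h he
    exact h.2.1 he.1
  · rintro ⟨p, q⟩ h
    simp only [Finset.mem_sigma, Finset.mem_erase] at h ⊢
    exact ⟨h.2.2, fun e => h.2.1 e.symm, h.1⟩
  · rintro ⟨p, q⟩ _; rfl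

/-- A compatible family of chains, one for each set of colours. -/
structure ColorChain (H : SimpleGraph V) (col : V → ι) (W : Finset V)
    (c : Finset ι → Finset V → ZMod 2) (S : Finset ι) : Prop where
  chain : IndepChain H (colored col W S) S.card (c S)
  boundary : bdry (c S) = fun σ => ∑ p ∈ S, c (S.erase p) σ

variable {H : SimpleGraph V} {col : V → ι} {W : Finset V}

/-- A transversal maps the simplex on its colours isomorphically onto a simplex of the independence
complex. -/
theorem colorChain_of_transversal {T : Finset ι} {J : Finset V} (hJW : J ⊆ W)
    (hJ : H.IsIndepSet (J : Set V)) (hinj : Set.InjOn col (J : Set V)) (himg : J.image col = T)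
    {S : Finset ι} (hS : S ⊆ T) :
    ColorChain H col W (fun S σ => if σ = colored col J S then 1 else 0) S := by
  have himgS : ∀ S ⊆ T, (colored col J S).image col = S := by
    intro S hS
    ext p
    simp only [Finset.mem_image, mem_colored]
    constructor
    · rintro ⟨v, hv, rfl⟩; exact hv.2
    · intro hp
      have := hS hp
      rw [← himg, Finset.mem_image] at this
      obtain ⟨v, hv, rfl⟩ := this
      exact ⟨v, ⟨hv, hp⟩, rfl⟩
  refine ⟨?_, ?_⟩
  · intro σ hσ
    simp only [ne_eq, ite_eq_right_iff, one_ne_zero, imp_false, not_not] at hσ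
    subst hσ
    refine ⟨?_, ?_, ?_⟩
    · intro v hv
      rw [mem_colored] at hv ⊢
      exact ⟨hJW hv.1, hv.2⟩
    · exact hJ.mono (Finset.coe_subset.2 colored_subset)
    · conv_rhs => rw [← himgS S hS]
      exact (Finset.card_image_of_injOn (hinj.mono (Finset.coe_subset.2 colored_subset))).symm
  · funext σ
    simp only [bdry]
    rw [← Finset.sum_filter_ne_zero, ← Finset.sum_filter_ne_zero (s := S)]
    simp only [ne_eq, ite_eq_right_iff, one_ne_zero, imp_false, not_not]
    have herase : ∀ v ∈ J, colored col J (S.erase (col v)) = (colored col J S).erase v := by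
      intro v hv
      ext w
      simp only [mem_colored, Finset.mem_erase]
      constructor
      · rintro ⟨h1, h2, h3⟩
        exact ⟨fun e => h2 (e ▸ rfl), h1, h3⟩
      · rintro ⟨h1, h2, h3⟩
        exact ⟨h2, fun e => h1 (hinj h2 hv e), h3⟩
    refine Finset.sum_bij (fun v _ => col v) ?_ ?_ ?_ ?_
    · intro v hv
      simp only [Finset.mem_filter, Finset.mem_compl] at hv ⊢
      have hvJ : v ∈ colored col J S := hv.2 ▸ Finset.mem_insert_self v σ
      rw [mem_colored] at hvJ
      exact ⟨hvJ.2, by rw [herase v hvJ.1, ← hv.2, Finset.erase_insert hv.1]⟩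
    · intro v hv w hw hvw
      simp only [Finset.mem_filter, Finset.mem_compl] at hv hw
      have hvJ : v ∈ colored col J S := hv.2 ▸ Finset.mem_insert_self v σ
      have hwJ : w ∈ colored col J S := hw.2 ▸ Finset.mem_insert_self w σ
      exact hinj (mem_colored.1 hvJ).1 (mem_colored.1 hwJ).1 hvw
    · intro p hp
      simp only [Finset.mem_filter] at hp
      have := hS hp.1
      rw [← himg, Finset.mem_image] at this
      obtain ⟨v, hv, rfl⟩ := this
      rw [herase v hv] at hp
      have hvS : v ∈ colored col J S := mem_colored.2 ⟨hv, hp.1⟩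
      refine ⟨v, ?_, rfl⟩
      simp only [Finset.mem_filter, Finset.mem_compl]
      rw [hp.2]
      exact ⟨by simp, Finset.insert_erase hvS⟩
    · intro v hv
      simp only [Finset.mem_filter, Finset.mem_compl] at hv
      have hvJ : v ∈ colored col J S := hv.2 ▸ Finset.mem_insert_self v σ
      rw [mem_colored] at hvJ
      rw [if_pos hv.2, if_pos]
      rw [herase v hvJ.1, ← hv.2, Finset.erase_insert hv.1]

/-- This is a chain map from the simplex on T. On faces avoiding i it is given by the transversal;
faces containing i are filled in order of size, so vanishing homology is needed only for sets of
colours containing i. -/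
theorem exists_colorChain {T : Finset ι} {i : ι} (hIT : FullIT H col W (T.erase i))
    (hfill : ∀ Z ⊆ T, i ∈ Z → Fills H (colored col W Z) (Z.card - 1)) :
    ∃ c, c ∅ ∅ = 1 ∧ ∀ S ⊆ T, ColorChain H col W c S := by
  obtain ⟨J, hJW, hJ, hinj, himg⟩ := hIT
  suffices h : ∀ m : ℕ, ∃ c : Finset ι → Finset V → ZMod 2, c ∅ ∅ = 1 ∧
      ∀ S ⊆ T, (i ∉ S ∨ S.card ≤ m) → ColorChain H col W c S by
    obtain ⟨c, h0, h1⟩ := h T.card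
    exact ⟨c, h0, fun S hS => h1 S hS (Or.inr (Finset.card_le_card hS))⟩
  intro m
  induction m with
  | zero =>
    refine ⟨fun S σ => if σ = colored col J S then 1 else 0, ?_, ?_⟩
    · simp [colored]
    · intro S hS hor
      refine colorChain_of_transversal hJW hJ hinj himg fun p hp => ?_
      have : i ∉ S := by
        rcases hor with h | h
        · exact h
        · rw [Finset.card_eq_zero.1 (Nat.le_zero.1 h)]; simp
      exact Finset.mem_erase.2 ⟨fun e => this (e ▸ hp), hS hp⟩
  | succ m ih =>
    obtain ⟨c, h0, hc⟩ := ih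
    have key : ∀ S : Finset ι, S ⊆ T ∧ i ∈ S ∧ S.card = m + 1 → ∃ e : Finset V → ZMod 2,
        IndepChain H (colored col W S) S.card e ∧
          bdry e = fun σ => ∑ p ∈ S, c (S.erase p) σ := by
      rintro S ⟨hS, hiS, hcard⟩
      have hcc : ∀ p ∈ S, (S.erase p).card = m := fun p hp => by
        rw [Finset.card_erase_of_mem hp]; omega
      have hCC : ∀ p ∈ S, ColorChain H col W c (S.erase p) := fun p hp =>
        hc _ ((Finset.erase_subset _ _).trans hS) (Or.inr (hcc p hp).le)
      have hf := hfill S hS hiS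
      rw [hcard, Nat.add_sub_cancel] at hf
      rw [hcard]
      refine hf _ (IndepChain.sum fun p hp => ?_) ?_
      · have := (hCC p hp).chain.mono (colored_mono (Finset.erase_subset p S))
        rwa [hcc p hp] at this
      · rw [bdry_sum]
        funext σ
        rw [Finset.sum_congr rfl fun p hp => congrFun (hCC p hp).boundary σ]
        exact sum_erase_erase CharTwo.add_self_eq_zero S (fun S => c S σ)
    classical
    choose! e he using key
    refine ⟨fun S => if S ⊆ T ∧ i ∈ S ∧ S.card = m + 1 then e S else c S, ?_, ?_⟩
    · simpa using h0
    · intro S hS hor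
      have hlow : ∀ p ∈ S, (if S.erase p ⊆ T ∧ i ∈ S.erase p ∧ (S.erase p).card = m + 1
          then e (S.erase p) else c (S.erase p)) = c (S.erase p) := by
        intro p hp
        rw [if_neg]
        rintro ⟨-, h2, h3⟩
        rw [Finset.card_erase_of_mem hp] at h3
        rcases hor with h | h
        · exact h (Finset.mem_of_mem_erase h2)
        · omega
      by_cases hS' : S ⊆ T ∧ i ∈ S ∧ S.card = m + 1
      · obtain ⟨he1, he2⟩ := he S hS'
        refine ⟨by simpa only [if_pos hS'] using he1, ?_⟩
        simp only [if_pos hS']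
        rw [he2]
        funext σ
        exact Finset.sum_congr rfl fun p hp => by rw [hlow p hp]
      · obtain ⟨he1, he2⟩ := hc S hS (by
          rcases hor with h | h
          · exact Or.inl h
          · by_cases hi : i ∈ S
            · exact Or.inr (by by_contra hh; exact hS' ⟨hS, hi, by omega⟩)
            · exact Or.inl hi)
        refine ⟨by simpa only [if_neg hS'] using he1, ?_⟩
        simp only [if_neg hS']
        rw [he2]
        funext σ
        exact Finset.sum_congr rfl fun p hp => by rw [hlow p hp]

/-- In a set with exactly one repeated colour, exactly two elements can be removed without losing
a colour. -/
theorem card_removable {σ : Finset V} (h : (σ.image col).card + 1 = σ.card) :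
    (σ.filter fun v => (σ.erase v).image col = σ.image col).card = 2 := by
  obtain ⟨a, ha, b, hb, hab, hcol⟩ := Finset.exists_ne_map_eq_of_card_lt_of_maps_to
    (s := σ) (t := σ.image col) (f := col) (by omega) (fun v hv => Finset.mem_image_of_mem _ hv)
  have himg : ∀ a ∈ σ, ∀ b ∈ σ, a ≠ b → col a = col b →
      (σ.erase a).image col = σ.image col := by
    intro a ha b hb hab hcol
    refine (Finset.image_subset_image (Finset.erase_subset _ _)).antisymm fun p hp => ?_
    obtain ⟨v, hv, rfl⟩ := Finset.mem_image.1 hp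
    by_cases hva : v = a
    · exact Finset.mem_image.2 ⟨b, Finset.mem_erase.2 ⟨hab.symm, hb⟩, by rw [hva, hcol]⟩
    · exact Finset.mem_image_of_mem _ (Finset.mem_erase.2 ⟨hva, hv⟩)
  have hinj : Set.InjOn col (σ.erase a : Set V) := by
    apply Finset.injOn_of_card_image_eq
    rw [himg a ha b hb hab hcol, Finset.card_erase_of_mem ha]
    omega
  rw [Finset.card_eq_two]
  refine ⟨a, b, hab, ?_⟩
  ext v
  simp only [Finset.mem_filter, Finset.mem_insert, Finset.mem_singleton]
  constructor
  · rintro ⟨hv, hvi⟩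
    by_contra hcon
    push Not at hcon
    have hvp : col v ∈ (σ.erase v).image col := hvi ▸ Finset.mem_image_of_mem _ hv
    obtain ⟨w, hw, hwv⟩ := Finset.mem_image.1 hvp
    rw [Finset.mem_erase] at hw
    by_cases hwa : w = a
    · exact hcon.2 (hinj (by simp [hv, hcon.1]) (by simp [hb, hab.symm])
        (by rw [← hwv, hwa, hcol]))
    · exact hw.1 (hinj (by simp [hw.2, hwa]) (by simp [hv, hcon.1]) hwv)
  · rintro (rfl | rfl)
    · exact ⟨ha, himg _ ha _ hb hab hcol⟩
    · exact ⟨hb, himg _ hb _ ha hab.symm hcol.symm⟩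

/-- The parity count in Sperner's lemma: a rainbow σ has one facet with colour set S \ {p}, and any
other σ has zero or two. -/
theorem removable_parity {S : Finset ι} {p : ι} (hp : p ∈ S) {σ : Finset V}
    (hsub : σ.image col ⊆ S) (hcard : σ.card = S.card) :
    (((σ.filter fun v => (σ.erase v).image col = S.erase p).card : ℕ) : ZMod 2) =
      if σ.image col = S then 1 else 0 := by
  split_ifs with h
  · have hinj : Set.InjOn col (σ : Set V) :=
      Finset.injOn_of_card_image_eq (by rw [h, hcard])
    have : (σ.filter fun v => (σ.erase v).image col = S.erase p).card = 1 := by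
      rw [← h, Finset.mem_image] at hp
      obtain ⟨u, hu, rfl⟩ := hp
      rw [Finset.card_eq_one]
      refine ⟨u, ?_⟩
      ext v
      simp only [Finset.mem_filter, Finset.mem_singleton]
      constructor
      · rintro ⟨hv, hvi⟩
        by_contra hvu
        have : col u ∈ (σ.erase v).image col :=
          Finset.mem_image_of_mem _ (Finset.mem_erase.2 ⟨Ne.symm hvu, hu⟩)
        rw [hvi] at this
        simp at this
      · rintro rfl
        refine ⟨hu, ?_⟩
        ext q
        simp only [← h, Finset.mem_image, Finset.mem_erase]
        constructor
        · rintro ⟨w, hw, rfl⟩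
          exact ⟨fun e => hw.1 (hinj hw.2 hu e), w, hw.2, rfl⟩
        · rintro ⟨hq, w, hw, rfl⟩
          exact ⟨w, ⟨fun e => hq (e ▸ rfl), hw⟩, rfl⟩
    rw [this]; rfl
  · by_cases h2 : σ.image col = S.erase p
    · have := card_removable (col := col) (σ := σ) (by
        rw [h2, Finset.card_erase_of_mem hp, hcard]
        have := Finset.card_pos.2 ⟨p, hp⟩
        omega)
      rw [h2] at this
      rw [this]; rfl
    · rw [Finset.filter_false_of_mem]
      · simp
      · intro v hv hvi
        have h3 : S.erase p ⊆ σ.image col := by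
          rw [← hvi]; exact Finset.image_subset_image (Finset.erase_subset _ _)
        by_cases hpσ : p ∈ σ.image col
        · exact h (hsub.antisymm fun q hq => by
            by_cases hqp : q = p
            · exact hqp ▸ hpσ
            · exact h3 (Finset.mem_erase.2 ⟨hqp, hq⟩))
        · exact h2 (Finset.Subset.antisymm (fun q hq =>
            Finset.mem_erase.2 ⟨fun e => hpσ (e ▸ hq), hsub hq⟩) h3)

/-- The number of rainbow simplices of a compatible family of chains is odd. -/
theorem rainbow_sum_eq_one {T : Finset ι} {c : Finset ι → Finset V → ZMod 2} (h0 : c ∅ ∅ = 1)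
    (hc : ∀ S ⊆ T, ColorChain H col W c S) :
    ∀ S ⊆ T, ∑ σ : Finset V, (if σ.image col = S then c S σ else 0) = 1 := by
  intro S
  induction S using Finset.strongInduction with
  | H S ih =>
    intro hS
    rcases S.eq_empty_or_nonempty with rfl | ⟨p, hp⟩
    · rw [Finset.sum_eq_single ∅]
      · simpa using h0
      · intro σ _ hσ
        rw [if_neg]
        simpa using hσ
      · simp
    have hC := hc S hS
    have hCsub : ∀ S ⊆ T, ∀ σ, c S σ ≠ 0 → σ.image col ⊆ S := by
      intro S hS σ hσ q hq
      obtain ⟨v, hv, rfl⟩ := Finset.mem_image.1 hq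
      exact (mem_colored.1 (((hc S hS).chain σ hσ).1 hv)).2
    -- Of the terms of the boundary of `c S`, only the one for S \ {p} can contain sets showing all
    -- colours of S \ {p}, so induction applies.
    have h1 : ∑ τ : Finset V, (if τ.image col = S.erase p then bdry (c S) τ else 0) = 1 := by
      rw [← ih (S.erase p) (Finset.erase_ssubset hp) ((Finset.erase_subset _ _).trans hS)]
      refine Finset.sum_congr rfl fun τ _ => ?_
      split_ifs with hτ
      · rw [hC.boundary]
        refine Finset.sum_eq_single p (fun q hq hqp => ?_) (fun h => absurd hp h)
        by_contra hne
        have := hCsub _ ((Finset.erase_subset q S).trans hS) τ hne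
        rw [hτ] at this
        exact (Finset.mem_erase.1 (this (Finset.mem_erase.2 ⟨hqp, hq⟩))).1 rfl
      · rfl
    rw [← h1]
    have h2 : ∑ τ : Finset V, (if τ.image col = S.erase p then bdry (c S) τ else 0) =
        ∑ σ : Finset V, ∑ v ∈ σ, (if (σ.erase v).image col = S.erase p then c S σ else 0) := by
      have : ∀ τ : Finset V, (if τ.image col = S.erase p then bdry (c S) τ else 0) =
          ∑ v ∈ τᶜ, (if τ.image col = S.erase p then c S (insert v τ) else 0) := by
        intro τ
        split_ifs
        · rfl
        · simp
      rw [Finset.sum_congr rfl fun τ _ => this τ, Finset.sum_sigma', Finset.sum_sigma']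
      refine Finset.sum_bij' (fun x _ => ⟨insert x.2 x.1, x.2⟩) (fun x _ => ⟨x.1.erase x.2, x.2⟩)
        ?_ ?_ ?_ ?_ ?_
      · rintro ⟨τ, v⟩ h; simp
      · rintro ⟨τ, v⟩ h; simp
      · rintro ⟨τ, v⟩ h
        simp only [Finset.mem_sigma, Finset.mem_univ, Finset.mem_compl, true_and] at h
        simp [Finset.erase_insert h]
      · rintro ⟨τ, v⟩ h
        simp only [Finset.mem_sigma, Finset.mem_univ, true_and] at h
        simp [Finset.insert_erase h]
      · rintro ⟨τ, v⟩ h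
        simp only [Finset.mem_sigma, Finset.mem_univ, Finset.mem_compl, true_and] at h
        simp [Finset.erase_insert h]
    rw [h2]
    refine Finset.sum_congr rfl fun σ _ => ?_
    by_cases hσ : c S σ = 0
    · simp [hσ]
    · have hpar := removable_parity hp (hCsub S hS σ hσ) (hC.chain σ hσ).2.2
      rw [← Finset.sum_filter, Finset.sum_const, nsmul_eq_mul, hpar]
      split_ifs <;> simp

/-- A Hall-type theorem: if all colours but `i` have an independent transversal but `T` has none,
then there is a set of colours containing `i` that spans a graph with nonvanishing homology. -/
theorem exists_nonFilling {T : Finset ι} {i : ι}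
    (hIT : FullIT H col W (T.erase i)) (hno : ¬ FullIT H col W T) :
    ∃ Z ⊆ T, i ∈ Z ∧ NonFilling H (colored col W Z) (Z.card - 1) := by
  by_contra hcon
  push Not at hcon
  obtain ⟨c, h0, hc⟩ := exists_colorChain hIT fun Z hZ hi => by
    by_contra hf
    exact hcon Z hZ hi ⟨_, le_rfl, hf⟩
  have h1 := rainbow_sum_eq_one h0 hc T subset_rfl
  obtain ⟨σ, -, hσ⟩ := Finset.exists_ne_zero_of_sum_ne_zero (h1.trans_ne one_ne_zero)
  simp only [ne_eq, ite_eq_right_iff, Classical.not_imp] at hσ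
  obtain ⟨hsub, hind, hcard⟩ := (hc T subset_rfl).chain σ hσ.2
  exact hno ⟨σ, hsub.trans colored_subset, hind,
    Finset.injOn_of_card_image_eq (by rw [hσ.1, hcard]), hσ.1⟩

/-- Passing to a smallest set of colours without a transversal supplies the almost full transversal
that `exists_nonFilling` needs. -/
theorem exists_card_colored_le {T : Finset ι} {Δ : ℕ} (hdeg : ∀ v ∈ W, (nbr H W v).card ≤ Δ)
    (hno : ¬ FullIT H col W T) :
    ∃ Z ⊆ T, Z.Nonempty ∧ (colored col W Z).card ≤ 2 * Δ * (Z.card - 1) := by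
  induction T using Finset.strongInduction with
  | H T ih =>
    rcases T.eq_empty_or_nonempty with rfl | ⟨i, hi⟩
    · exact absurd ⟨∅, by simp, by simp, by simp, by simp⟩ hno
    by_cases hT : FullIT H col W (T.erase i)
    · obtain ⟨Z, hZ, hiZ, hZf⟩ := exists_nonFilling hT hno
      exact ⟨Z, hZ, ⟨i, hiZ⟩, hZf.card_le (card_nbr_le_of_le le_rfl colored_subset hdeg)⟩
    · obtain ⟨Z, hZ, h⟩ := ih _ (Finset.erase_ssubset hi) hT
      exact ⟨Z, hZ.trans (Finset.erase_subset _ _), h⟩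

end Transversals


/-! ### Critical blocks of colours and the odd case -/

section Blocks

variable {V ι : Type*} [Fintype V] [DecidableEq V] [DecidableEq ι]

theorem exists_injOn_of_hall {α : Type*} [DecidableEq α] [Nonempty α] (P : Finset ι)
    (t : ι → Finset α) (h : ∀ S ⊆ P, S.card ≤ (S.biUnion t).card) :
    ∃ f : ι → α, Set.InjOn f (P : Set ι) ∧ ∀ p ∈ P, f p ∈ t p := by
  obtain ⟨f, hf, hft⟩ := (Finset.all_card_le_biUnion_card_iff_exists_injective
    (fun p : P => t p)).1 fun s => by
      have h1 := h (s.map (Function.Embedding.subtype _)) (by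
        intro p hp
        obtain ⟨⟨p', hp'⟩, -, rfl⟩ := Finset.mem_map.1 hp
        exact hp')
      rw [Finset.card_map, Finset.map_eq_image, Finset.image_biUnion] at h1
      exact h1
  refine ⟨fun p => if hp : p ∈ P then f ⟨p, hp⟩ else Classical.arbitrary α, ?_, ?_⟩
  · intro p hp p' hp' he
    rw [Finset.mem_coe] at hp hp'
    simp only [hp, hp', dif_pos] at he
    exact congrArg Subtype.val (hf he)
  · intro p hp
    simp only [hp, dif_pos]
    exact hft ⟨p, hp⟩

variable {H : SimpleGraph V} {col : V → ι} {W : Finset V} {C : Finset ι} {Δ : ℕ}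

/-- The data for an edge-minimal graph without an independent transversal of the colours `C`. -/
structure CriticalBlock (H : SimpleGraph V) (col : V → ι) (W : Finset V) (C : Finset ι) (Δ : ℕ) :
    Prop where
  proper : ∀ u v, H.Adj u v → col u ≠ col v
  deg : ∀ v ∈ W, (nbr H W v).card ≤ Δ
  mem : ∀ v ∈ W, col v ∈ C
  card_gt : ∀ Z ⊆ C, Z.Nonempty → Z ≠ C → 2 * Δ * Z.card < (colored col W Z).card + 2 * Δ
  count : 4 * Δ * (C.card - 1) < 2 * W.card + Δ
  no : ¬ FullIT H col W C
  minimal : ∀ x y, H.Adj x y → FullIT (H.deleteEdges {s(x, y)}) col W C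

namespace CriticalBlock

/-- A transversal that appears on deleting xy must use both x and y; its other vertices survive the
explosion. -/
theorem transversal_of_edge (h : CriticalBlock H col W C Δ) {x y : V} (hxy : H.Adj x y) :
    x ∈ W ∧ y ∈ W ∧ ∃ J ⊆ W, H.IsIndepSet (J : Set V) ∧ Set.InjOn col (J : Set V) ∧
      J.image col = (C.erase (col x)).erase (col y) ∧ ∀ v ∈ J, ¬ H.Adj x v ∧ ¬ H.Adj y v := by
  obtain ⟨J, hJW, hJ, hinj, himg⟩ := h.minimal x y hxy
  have hadj : ∀ u ∈ J, ∀ v ∈ J, H.Adj u v → u = x ∧ v = y ∨ u = y ∧ v = x := by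
    intro u hu v hv huv
    by_contra hcon
    refine hJ hu hv huv.ne ?_
    rw [SimpleGraph.deleteEdges_adj]
    exact ⟨huv, by simpa using hcon⟩
  have hxyJ : x ∈ J ∧ y ∈ J := by
    by_contra hcon
    refine h.no ⟨J, hJW, fun u hu v hv _ huv => hcon ?_, hinj, himg⟩
    rcases hadj u hu v hv huv with ⟨rfl, rfl⟩ | ⟨rfl, rfl⟩
    · exact ⟨hu, hv⟩
    · exact ⟨hv, hu⟩
  refine ⟨hJW hxyJ.1, hJW hxyJ.2, (J.erase x).erase y, ?_, ?_, ?_, ?_, ?_⟩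
  · exact ((Finset.erase_subset _ _).trans (Finset.erase_subset _ _)).trans hJW
  · intro u hu v hv _ huv
    simp only [Finset.coe_erase, Set.mem_sdiff, Finset.mem_coe, Set.mem_singleton_iff] at hu hv
    rcases hadj u hu.1.1 v hv.1.1 huv with e | e
    · exact hu.1.2 e.1
    · exact hu.2 e.1
  · refine hinj.mono ?_
    exact_mod_cast (Finset.erase_subset _ _).trans (Finset.erase_subset _ _)
  · ext p
    simp only [Finset.mem_image, Finset.mem_erase, ← himg]
    constructor
    · rintro ⟨v, ⟨hvy, hvx, hv⟩, rfl⟩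
      exact ⟨fun e => hvy (hinj hv hxyJ.2 e), fun e => hvx (hinj hv hxyJ.1 e), v, hv, rfl⟩
    · rintro ⟨hy, hx, v, hv, rfl⟩
      exact ⟨v, ⟨fun e => hy (e ▸ rfl), fun e => hx (e ▸ rfl), hv⟩, rfl⟩
  · intro v hv
    simp only [Finset.mem_erase] at hv
    constructor
    · intro hxv
      rcases hadj x hxyJ.1 v hv.2.2 hxv with e | e
      · exact hv.1 e.2
      · exact hv.2.1 e.2
    · intro hyv
      rcases hadj y hxyJ.2 v hv.2.2 hyv with e | e
      · exact hv.1 e.2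
      · exact hv.2.1 e.2

/-- After exploding xy, merge the colours of x and y. The graph has no transversal of the |C|-1
merged colours, since x or y could be added to it, but it has one missing only the merged colour.
Hence the Hall-type theorem gives a set containing the merged colour. -/
theorem nonFilling_explosion (h : CriticalBlock H col W C Δ) {x y : V} (hxy : H.Adj x y) :
    NonFilling H (W \ (nbr H W x ∪ nbr H W y)) (C.card - 2) := by
  obtain ⟨hx, hy, J, hJW, hJ, hinj, himg, hJxy⟩ := h.transversal_of_edge hxy
  set W' := W \ (nbr H W x ∪ nbr H W y) with hW'
  have hmW' : ∀ v, v ∈ W' ↔ v ∈ W ∧ ¬ H.Adj x v ∧ ¬ H.Adj y v := by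
    intro v; simp only [hW', Finset.mem_sdiff, Finset.mem_union, mem_nbr]; tauto
  have hij : col x ≠ col y := h.proper x y hxy
  set col' : V → ι := fun v => if col v = col y then col x else col v with hcol'
  have hmerge : ∀ u v, col u = col v → col' u = col' v := by
    intro u v e; simp [hcol', e]
  have hJcol : ∀ v ∈ J, col' v = col v := by
    intro v hv
    have : col v ∈ J.image col := Finset.mem_image_of_mem _ hv
    rw [himg, Finset.mem_erase] at this
    simp [hcol', this.1]
  have hIT : FullIT H col' W' ((C.erase (col y)).erase (col x)) := by
    refine ⟨J, fun v hv => (hmW' v).2 ⟨hJW hv, hJxy v hv⟩, hJ, ?_, ?_⟩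
    · intro u hu v hv huv
      rw [hJcol u hu, hJcol v hv] at huv
      exact hinj hu hv huv
    · rw [Finset.erase_right_comm, ← himg]
      exact Finset.image_congr fun v hv => hJcol v hv
  have hno : ¬ FullIT H col' W' (C.erase (col y)) := by
    rintro ⟨J₁, hJ₁W, hJ₁, hinj₁, himg₁⟩
    have hcard₁ : J₁.card = C.card - 1 := by
      rw [← Finset.card_erase_of_mem (h.mem y hy), ← himg₁, Finset.card_image_of_injOn hinj₁]
    have hinj₁' : Set.InjOn col (J₁ : Set V) := fun u hu v hv huv => hinj₁ hu hv (hmerge u v huv)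
    -- The merged colour is represented once, so one of the colours of x and y is free, and neither
    -- vertex has neighbours in `J₁`.
    obtain ⟨b, hb, hbW, hbJ⟩ : ∃ b, col b ∉ J₁.image col ∧ b ∈ W ∧ ∀ v ∈ J₁, ¬ H.Adj b v := by
      by_cases hxJ : col x ∈ J₁.image col
      · refine ⟨y, fun hyJ => ?_, hy, fun v hv => ((hmW' v).1 (hJ₁W hv)).2.2⟩
        obtain ⟨u, hu, hux⟩ := Finset.mem_image.1 hxJ
        obtain ⟨v, hv, hvy⟩ := Finset.mem_image.1 hyJ
        have : u = v := hinj₁ hu hv (by simp [hcol', hux, hvy])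
        exact hij (by rw [← hux, ← hvy, this])
      · exact ⟨x, hxJ, hx, fun v hv => ((hmW' v).1 (hJ₁W hv)).2.1⟩
    have hbJ₁ : b ∉ J₁ := fun hb' => hb (Finset.mem_image_of_mem _ hb')
    have hsubW : insert b J₁ ⊆ W :=
      Finset.insert_subset hbW fun v hv => ((hmW' v).1 (hJ₁W hv)).1
    have hinjb : Set.InjOn col (insert b J₁ : Finset V) := by
      rw [Finset.coe_insert, Set.injOn_insert (by simpa using hbJ₁)]
      exact ⟨hinj₁', by simpa using hb⟩
    refine h.no ⟨insert b J₁, hsubW, ?_, hinjb, ?_⟩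
    · rw [Finset.coe_insert]
      intro u hu v hv huv hadj
      rcases hu with rfl | hu <;> rcases hv with rfl | hv
      · exact huv rfl
      · exact hbJ v hv hadj
      · exact hbJ u hu hadj.symm
      · exact hJ₁ hu hv huv hadj
    · refine Finset.eq_of_subset_of_card_le (fun p hp => ?_) ?_
      · obtain ⟨v, hv, rfl⟩ := Finset.mem_image.1 hp
        exact h.mem v (hsubW hv)
      · rw [Finset.card_image_of_injOn hinjb, Finset.card_insert_of_notMem hbJ₁, hcard₁]
        omega
  obtain ⟨Z, hZ, hxZ, hZf⟩ := exists_nonFilling hIT hno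
  have hyZ : col y ∉ Z := fun hy => (Finset.mem_erase.1 (hZ hy)).1 rfl
  have hcolored : colored col' W' Z = colored col W' (insert (col y) Z) := by
    ext v
    simp only [mem_colored, Finset.mem_insert, hcol']
    by_cases hv : col v = col y
    · simp [hv, hxZ]
    · simp [hv]
  rw [hcolored] at hZf
  have hc1 := hZf.card_le (card_nbr_le_of_le le_rfl (colored_subset.trans Finset.sdiff_subset) h.deg)
  have hZC : insert (col y) Z ⊆ C :=
    Finset.insert_subset (h.mem y hy) (hZ.trans (Finset.erase_subset _ _))
  have hcardZ := Finset.card_insert_of_notMem hyZ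
  have hpos := Finset.card_pos.2 ⟨_, hxZ⟩
  by_cases hne : insert (col y) Z = C
  · rw [hne, colored, Finset.filter_true_of_mem fun v hv => h.mem v ((hmW' v).1 hv).1] at hZf
    rw [hne] at hcardZ
    rwa [hcardZ]
  -- A smaller set of colours has too many vertices, even after losing 2Δ in the explosion, for
  -- `NonFilling.card_le`.
  · exfalso
    have h1 := h.card_gt _ hZC ⟨_, Finset.mem_insert_self _ _⟩ hne
    have h2 : (colored col W (insert (col y) Z)).card ≤
        (colored col W' (insert (col y) Z)).card + (nbr H W x ∪ nbr H W y).card := by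
      refine le_trans (Finset.card_le_card fun v hv => ?_) (Finset.card_union_le _ _)
      rw [mem_colored] at hv
      rw [Finset.mem_union, mem_colored, hW', Finset.mem_sdiff]
      tauto
    have h3 := (card_sdiff_explosion h.deg hx hy).2
    obtain ⟨m, hm⟩ : ∃ m, Z.card = m + 1 := ⟨Z.card - 1, by omega⟩
    rw [hcardZ, hm] at h1
    rw [hm, Nat.add_sub_cancel] at hc1
    have : 2 * Δ * (m + 1 + 1) = 2 * Δ * m + 4 * Δ := by ring
    omega

theorem explodes (h : CriticalBlock H col W C Δ) (hC : 2 ≤ C.card) :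
    ExplodesToBicliques H W Δ (C.card - 2) := by
  have e : C.card - 2 + 1 = C.card - 1 := by omega
  refine ⟨h.deg, by rw [e]; exact h.count, fun x hx y hy hxy => ?_⟩
  have h1 := h.nonFilling_explosion hxy
  refine h1.exists_cover (card_nbr_le_of_le le_rfl Finset.sdiff_subset h.deg) ?_
  have h2 := card_sdiff_explosion h.deg hx hy
  have h3 := h.count
  have : 4 * Δ * (C.card - 2 + 1) = 4 * Δ * (C.card - 2) + 4 * Δ := by ring
  rw [e] at this
  omega

theorem colored_nonempty (h : CriticalBlock H col W C Δ) (hC : 2 ≤ C.card) {Z : Finset ι}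
    (hZC : Z ⊆ C) (hZ : Z.Nonempty) : (colored col W Z).Nonempty := by
  obtain ⟨p, hp⟩ := hZ
  have h1 := h.card_gt {p} (by simpa using hZC hp) (by simp) (by rintro rfl; simp at hC)
  rw [Finset.card_singleton] at h1
  have h2 : (colored col W {p}).Nonempty := by
    rw [← Finset.card_pos]; omega
  exact h2.mono (colored_mono (by simpa using hp))

theorem exists_edge (h : CriticalBlock H col W C Δ) (hC : 2 ≤ C.card) :
    ∃ x ∈ W, ∃ y ∈ W, H.Adj x y := by
  by_contra hcon
  push Not at hcon
  -- Without edges inside W the degree bound may be taken to be 0, which would leave some nonempty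
  -- set of colours without vertices.
  obtain ⟨Z, hZ, hZne, hle⟩ := exists_card_colored_le (Δ := 0) (W := W) (H := H) (fun v hv => by
    rw [Nat.le_zero, Finset.card_eq_zero, Finset.eq_empty_iff_forall_notMem]
    intro w hw
    rw [mem_nbr] at hw
    exact hcon v hv w hw.1 hw.2) h.no
  have := Finset.card_pos.2 (h.colored_nonempty hC hZ hZne)
  simp at hle
  simp [hle] at this

theorem exists_cover (h : CriticalBlock H col W C Δ) (hC : 2 ≤ C.card) :
    ∃ cl sd, BicliqueCover H W (C.card - 1) cl sd ∧
      ∀ x ∈ W, ∀ y ∈ W, H.Adj x y → cl x = cl y := by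
  obtain ⟨x, hx, y, hy, hxy⟩ := h.exists_edge hC
  have hE := h.explodes hC
  obtain ⟨cl, sd, hcov⟩ := hE.exists_cover hx hy hxy
  refine ⟨cl, sd, ?_, fun x hx y hy hxy => hE.class_eq_of_adj hcov hx hy hxy⟩
  rwa [show C.card - 2 + 1 = C.card - 1 by omega] at hcov

end CriticalBlock

/-- A weighted bound for the size of a set whose intersection with some classes is small. -/
theorem card_le_of_classes {S : Finset V} {cl : V → ℕ} {U : Finset ℕ}
    (hU : ∀ l ∈ U, (S.filter fun v => cl v = l).card ≤ Δ)
    (hall : ∀ l ∈ S.image cl, (S.filter fun v => cl v = l).card ≤ 2 * Δ) (hUS : U ⊆ S.image cl) :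
    S.card ≤ Δ * U.card + 2 * Δ * (S.image cl \ U).card := by
  rw [Finset.card_eq_sum_card_image cl S, ← Finset.sum_sdiff hUS, add_comm]
  refine add_le_add ?_ ?_
  · rw [mul_comm]; exact Finset.sum_le_card_nsmul _ _ _ hU
  · rw [mul_comm]
    exact Finset.sum_le_card_nsmul _ _ _ fun l hl => hall l (Finset.mem_sdiff.1 hl).1

/-- The classes met by the vertices with colours in `Z`. -/
def classesOf (col : V → ι) (W : Finset V) (cl : V → ℕ) (Z : Finset ι) : Finset ℕ :=
  (colored col W Z).image cl

theorem mem_classesOf {cl : V → ℕ} {Z : Finset ι} {l : ℕ} :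
    l ∈ classesOf col W cl Z ↔ ∃ v ∈ W, col v ∈ Z ∧ cl v = l := by
  simp [classesOf, mem_colored, and_assoc]

theorem classesOf_union {cl : V → ℕ} (Y Z : Finset ι) :
    classesOf col W cl (Y ∪ Z) = classesOf col W cl Y ∪ classesOf col W cl Z := by
  ext l
  simp only [mem_classesOf, Finset.mem_union]
  constructor
  · rintro ⟨v, hv, h | h, e⟩
    · exact Or.inl ⟨v, hv, h, e⟩
    · exact Or.inr ⟨v, hv, h, e⟩
  · rintro (⟨v, hv, h, e⟩ | ⟨v, hv, h, e⟩)
    · exact ⟨v, hv, Or.inl h, e⟩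
    · exact ⟨v, hv, Or.inr h, e⟩

theorem classesOf_mono {cl : V → ℕ} {Y Z : Finset ι} (h : Y ⊆ Z) :
    classesOf col W cl Y ⊆ classesOf col W cl Z :=
  Finset.image_subset_image (colored_mono h)

namespace CriticalBlock

variable {cl : V → ℕ} {sd : V → Bool}

theorem classesOf_subset (hcov : BicliqueCover H W (C.card - 1) cl sd) (Z : Finset ι) :
    classesOf col W cl Z ⊆ Finset.range (C.card - 1) := by
  intro l hl
  obtain ⟨v, hv, -, rfl⟩ := mem_classesOf.1 hl
  exact Finset.mem_range.2 (hcov.lt v hv)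

/-- Each class holds at most 2Δ vertices, while the colours of Z have more than 2Δ(|Z|-1). -/
theorem card_le_classesOf (h : CriticalBlock H col W C Δ)
    (hcov : BicliqueCover H W (C.card - 1) cl sd) {Z : Finset ι} (hZ : Z ⊆ C) (hne : Z ≠ C) :
    Z.card ≤ (classesOf col W cl Z).card := by
  rcases Z.eq_empty_or_nonempty with rfl | hZne
  · simp
  have h1 := h.card_gt Z hZ hZne hne
  have h2 := hcov.card_filter_le h.deg (classesOf_subset (col := col) hcov Z)
  have h3 : (colored col W Z).card ≤ (W.filter fun v => cl v ∈ classesOf col W cl Z).card := by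
    refine Finset.card_le_card fun v hv => Finset.mem_filter.2 ⟨(mem_colored.1 hv).1, ?_⟩
    exact Finset.mem_image_of_mem _ hv
  by_contra hcon
  have h4 : 2 * Δ * ((classesOf col W cl Z).card + 1) ≤ 2 * Δ * Z.card :=
    Nat.mul_le_mul_left _ (by omega)
  rw [Nat.mul_add, Nat.mul_one] at h4
  omega

/-- If two vertices of the same class are not adjacent, the remaining colours violate Hall's
condition. -/
theorem adj_of_hall (h : CriticalBlock H col W C Δ)
    (hadj : ∀ x ∈ W, ∀ y ∈ W, H.Adj x y → cl x = cl y) {v w : V} (hv : v ∈ W) (hw : w ∈ W)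
    (hvw : cl v = cl w) (hcol : col v ≠ col w) {t : ι → Finset ℕ}
    (ht : ∀ p, t p ⊆ (classesOf col W cl {p}).erase (cl v))
    (hall : ∀ S ⊆ (C.erase (col v)).erase (col w), S.card ≤ (S.biUnion t).card) : H.Adj v w := by
  by_contra hnadj
  set P := (C.erase (col v)).erase (col w) with hP
  -- Edges lie inside classes, so picking the remaining colours from distinct classes other than
  -- that of v and w would complete v, w to a transversal.
  obtain ⟨f, hf, hft⟩ := exists_injOn_of_hall P t hall
  have hex : ∀ p ∈ P, ∃ u ∈ W, col u = p ∧ cl u = f p := by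
    intro p hp
    have := Finset.mem_of_mem_erase (ht p (hft p hp))
    simpa [mem_classesOf] using this
  have : Nonempty V := ⟨v⟩
  choose! g hgW hgcol hgcl using hex
  have hgne : ∀ p ∈ P, cl (g p) ≠ cl v := by
    intro p hp
    rw [hgcl p hp]
    exact (Finset.mem_erase.1 (ht p (hft p hp))).1
  have hPm : ∀ p ∈ P, p ≠ col v ∧ p ≠ col w ∧ p ∈ C := by
    intro p hp
    simp only [hP, Finset.mem_erase] at hp
    tauto
  refine h.no ⟨insert v (insert w (P.image g)), ?_, ?_, ?_, ?_⟩
  · intro u hu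
    simp only [Finset.mem_insert, Finset.mem_image] at hu
    rcases hu with rfl | rfl | ⟨p, hp, rfl⟩
    · exact hv
    · exact hw
    · exact hgW p hp
  · intro a ha b hb hab habadj
    simp only [Finset.coe_insert, Set.mem_insert_iff, Finset.coe_image, Set.mem_image,
      Finset.mem_coe] at ha hb
    rcases ha with rfl | rfl | ⟨p, hp, rfl⟩ <;> rcases hb with rfl | rfl | ⟨p', hp', rfl⟩
    · exact hab rfl
    · exact hnadj habadj
    · exact hgne p' hp' (hadj _ hv _ (hgW _ hp') habadj).symm
    · exact hnadj habadj.symm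
    · exact hab rfl
    · exact hgne p' hp' ((hadj _ hw _ (hgW _ hp') habadj).symm.trans hvw.symm)
    · exact hgne p hp (hadj _ (hgW _ hp) _ hv habadj)
    · exact hgne p hp ((hadj _ (hgW _ hp) _ hw habadj).trans hvw.symm)
    · have := hadj _ (hgW _ hp) _ (hgW _ hp') habadj
      rw [hgcl p hp, hgcl p' hp'] at this
      exact hab (by rw [hf hp hp' this])
  · intro a ha b hb hab
    simp only [Finset.coe_insert, Set.mem_insert_iff, Finset.coe_image, Set.mem_image,
      Finset.mem_coe] at ha hb
    rcases ha with rfl | rfl | ⟨p, hp, rfl⟩ <;> rcases hb with rfl | rfl | ⟨p', hp', rfl⟩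
    · rfl
    · exact absurd hab hcol
    · rw [hgcol p' hp'] at hab; exact absurd hab.symm (hPm p' hp').1
    · exact absurd hab.symm hcol
    · rfl
    · rw [hgcol p' hp'] at hab; exact absurd hab.symm (hPm p' hp').2.1
    · rw [hgcol p hp] at hab; exact absurd hab (hPm p hp).1
    · rw [hgcol p hp] at hab; exact absurd hab (hPm p hp).2.1
    · rw [hgcol p hp, hgcol p' hp'] at hab; rw [hab]
  · ext p
    simp only [Finset.image_insert, Finset.image_image, Finset.mem_insert, Finset.mem_image,
      Function.comp]
    constructor
    · rintro (rfl | rfl | ⟨p', hp', rfl⟩)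
      · exact h.mem v hv
      · exact h.mem w hw
      · exact h.mem _ (hgW p' hp')
    · intro hp
      by_cases h1 : p = col v
      · exact Or.inl h1
      by_cases h2 : p = col w
      · exact Or.inr (Or.inl h2)
      have hpP : p ∈ P := by simp [hP, h1, h2, hp]
      exact Or.inr (Or.inr ⟨p, hpP, hgcol p hpP⟩)

/-- For a minimal tight set of colours, vertices of the same class on the two sides of the split
are adjacent. -/
theorem adj_of_minimal (h : CriticalBlock H col W C Δ)
    (hcov : BicliqueCover H W (C.card - 1) cl sd)
    (hadj : ∀ x ∈ W, ∀ y ∈ W, H.Adj x y → cl x = cl y) {Y : Finset ι} (hYC : Y ⊆ C)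
    (hYcard : (classesOf col W cl Y).card = Y.card)
    (hYmin : ∀ Z ⊆ Y, Z.Nonempty → Z ≠ Y → Z.card < (classesOf col W cl Z).card)
    {v w : V} (hv : v ∈ W) (hvY : col v ∈ Y) (hw : w ∈ W) (hwY : col w ∉ Y) (hvw : cl v = cl w) :
    H.Adj v w := by
  have hclv : cl v ∈ classesOf col W cl Y := mem_classesOf.2 ⟨v, hv, hvY, rfl⟩
  refine h.adj_of_hall hadj hv hw hvw (fun e => hwY (e ▸ hvY))
    -- Colours of Y are matched inside the classes of Y, where strictness for proper subsets pays
    -- for the lost class of v; the other colours are matched outside, where tightness of Y leaves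
    -- enough room.
    (t := fun p => if p ∈ Y then (classesOf col W cl {p}).erase (cl v)
      else classesOf col W cl {p} \ classesOf col W cl Y) ?_ ?_
  · intro p
    split_ifs with hp
    · exact subset_rfl
    · intro l hl
      rw [Finset.mem_sdiff] at hl
      exact Finset.mem_erase.2 ⟨fun e => hl.2 (e ▸ hclv), hl.1⟩
  · intro S hS
    have hSm : ∀ p ∈ S, p ≠ col v ∧ p ≠ col w ∧ p ∈ C := by
      intro p hp
      have := hS hp
      simp only [Finset.mem_erase] at this
      tauto
    have h1 : (S ∩ Y).card ≤ ((classesOf col W cl (S ∩ Y)).erase (cl v)).card := by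
      rcases (S ∩ Y).eq_empty_or_nonempty with he | hne
      · simp [he]
      · have := hYmin (S ∩ Y) Finset.inter_subset_right hne (fun e => by
          have : col v ∈ S ∩ Y := by rw [e]; exact hvY
          exact (hSm _ (Finset.mem_inter.1 this).1).1 rfl)
        have := Finset.pred_card_le_card_erase (s := classesOf col W cl (S ∩ Y)) (a := cl v)
        omega
    have h2 : (S \ Y).card ≤ (classesOf col W cl (S \ Y) \ classesOf col W cl Y).card := by
      have h3 := h.card_le_classesOf hcov (Z := Y ∪ S \ Y)
        (Finset.union_subset hYC fun p hp => (hSm p (Finset.mem_sdiff.1 hp).1).2.2)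
        (fun e => by
          have := h.mem w hw
          rw [← e, Finset.mem_union, Finset.mem_sdiff] at this
          rcases this with h | h
          · exact hwY h
          · exact (hSm _ h.1).2.1 rfl)
      rw [Finset.card_union_of_disjoint Finset.disjoint_sdiff, classesOf_union,
        ← Finset.union_sdiff_self_eq_union,
        Finset.card_union_of_disjoint Finset.disjoint_sdiff, hYcard] at h3
      omega
    rw [← Finset.card_inter_add_card_sdiff S Y]
    refine (add_le_add h1 h2).trans ?_
    rw [← Finset.card_union_of_disjoint]
    · refine Finset.card_le_card fun l hl => ?_
      rw [Finset.mem_biUnion]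
      rcases Finset.mem_union.1 hl with hl | hl
      · rw [Finset.mem_erase, mem_classesOf] at hl
        obtain ⟨hlv, u, hu, huS, rfl⟩ := hl
        rw [Finset.mem_inter] at huS
        refine ⟨col u, huS.1, ?_⟩
        rw [if_pos huS.2, Finset.mem_erase]
        exact ⟨hlv, mem_classesOf.2 ⟨u, hu, by simp, rfl⟩⟩
      · rw [Finset.mem_sdiff, mem_classesOf] at hl
        obtain ⟨⟨u, hu, huS, rfl⟩, hlY⟩ := hl
        rw [Finset.mem_sdiff] at huS
        refine ⟨col u, huS.1, ?_⟩
        rw [if_neg huS.2, Finset.mem_sdiff]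
        exact ⟨mem_classesOf.2 ⟨u, hu, by simp, rfl⟩, hlY⟩
    · rw [Finset.disjoint_left]
      intro l hl hl'
      exact (Finset.mem_sdiff.1 hl').2
        (classesOf_mono Finset.inter_subset_right (Finset.mem_of_mem_erase hl))

/-- There are only |C|-1 classes, so omitting any one colour already gives a set meeting at most as
many classes as it has colours. -/
theorem exists_minimal_tight (h : CriticalBlock H col W C Δ) (hC : 2 ≤ C.card)
    (hcov : BicliqueCover H W (C.card - 1) cl sd) :
    ∃ Y ⊆ C, Y.Nonempty ∧ Y ≠ C ∧ (classesOf col W cl Y).card = Y.card ∧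
      ∀ Z ⊆ Y, Z.Nonempty → Z ≠ Y → Z.card < (classesOf col W cl Z).card := by
  obtain ⟨i, hi⟩ : C.Nonempty := Finset.card_pos.1 (by omega)
  obtain ⟨Y, hYle, hY⟩ := exists_minimal_le_of_wellFoundedLT
    (fun Y => Y ⊆ C ∧ Y.Nonempty ∧ Y ≠ C ∧ (classesOf col W cl Y).card ≤ Y.card) (C.erase i)
    ⟨Finset.erase_subset _ _, by
      rw [← Finset.card_pos, Finset.card_erase_of_mem hi]; omega,
      fun e => by
        have : i ∈ C.erase i := e.symm ▸ hi
        simp at this, by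
      rw [Finset.card_erase_of_mem hi]
      simpa using Finset.card_le_card (classesOf_subset (col := col) hcov (C.erase i))⟩
  obtain ⟨hYC, hYne, hYC', hYcard⟩ := hY.prop
  refine ⟨Y, hYC, hYne, hYC', hYcard.antisymm (h.card_le_classesOf hcov hYC hYC'), ?_⟩
  intro Z hZ hZne hZY
  by_contra hcon
  have hZC : Z ≠ C := fun e => hYC' (hYC.antisymm (e ▸ hZ))
  exact hZY (hZ.antisymm (hY.le_of_le ⟨hZ.trans hYC, hZne, hZC, not_lt.1 hcon⟩ hZ))

end CriticalBlock

/-- A sufficient condition for an independent transversal of an odd number of colours. -/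
theorem fullIT_of_odd {G : SimpleGraph V} (hproper : ∀ u v, G.Adj u v → col u ≠ col v)
    (hdeg : ∀ v ∈ W, (nbr G W v).card ≤ Δ) (hodd : Odd C.card) (hC : 3 ≤ C.card)
    (hmem : ∀ v ∈ W, col v ∈ C)
    (h1 : ∀ Z ⊆ C, Z.Nonempty → Z ≠ C → 2 * Δ * Z.card < (colored col W Z).card + 2 * Δ)
    (h2 : 4 * Δ * (C.card - 1) < 2 * W.card + Δ)
    (h3 : ∀ Z ⊆ C, Z.Nonempty → 2 * Z.card < C.card →
      2 * Δ * Z.card < (colored col W Z).card + Δ) : FullIT G col W C := by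
  by_contra hno
  obtain ⟨H, hle, hH, hmin⟩ := exists_edge_minimal (fun H => ¬ FullIT H col W C) hno
  have h : CriticalBlock H col W C Δ :=
    ⟨fun u v huv => hproper u v (hle huv), card_nbr_le_of_le hle subset_rfl hdeg, hmem, h1, h2,
      hH, fun x y hxy => not_not.1 (hmin x y hxy)⟩
  have hC2 : 2 ≤ C.card := by omega
  obtain ⟨cl, sd, hcov, hadj⟩ := h.exists_cover hC2
  obtain ⟨Y, hYC, hYne, hYC', hYcard, hYmin⟩ := h.exists_minimal_tight hC2 hcov
  set X := C \ Y with hX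
  have hXcard : X.card + Y.card = C.card := Finset.card_sdiff_add_card_eq_card hYC
  have hXne : X.Nonempty := by
    rw [hX, Finset.sdiff_nonempty]
    exact fun e => hYC' (hYC.antisymm e)
  have hXC : X ≠ C := by
    intro e
    rw [e] at hXcard
    have := Finset.card_pos.2 hYne
    omega
  -- In a class of `U` every vertex coloured in Y is adjacent to every vertex coloured in X, so
  -- either part lies in one neighbourhood and has at most Δ vertices.
  set U := classesOf col W cl Y ∩ classesOf col W cl X with hU
  have hUY : ∀ l ∈ U, ((colored col W Y).filter fun v => cl v = l).card ≤ Δ := by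
    intro l hl
    obtain ⟨w, hw, hwX, rfl⟩ := mem_classesOf.1 (Finset.mem_inter.1 hl).2
    refine (Finset.card_le_card fun v hv => ?_).trans (h.deg w hw)
    rw [Finset.mem_filter, mem_colored] at hv
    exact mem_nbr.2 ⟨hv.1.1, (h.adj_of_minimal hcov hadj hYC hYcard hYmin hv.1.1 hv.1.2 hw
      (Finset.mem_sdiff.1 hwX).2 hv.2).symm⟩
  have hUX : ∀ l ∈ U, ((colored col W X).filter fun v => cl v = l).card ≤ Δ := by
    intro l hl
    obtain ⟨w, hw, hwY, rfl⟩ := mem_classesOf.1 (Finset.mem_inter.1 hl).1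
    refine (Finset.card_le_card fun v hv => ?_).trans (h.deg w hw)
    rw [Finset.mem_filter, mem_colored] at hv
    exact mem_nbr.2 ⟨hv.1.1, h.adj_of_minimal hcov hadj hYC hYcard hYmin hw hwY hv.1.1
      (Finset.mem_sdiff.1 hv.1.2).2 hv.2.symm⟩
  have hall : ∀ Z l, l ∈ (colored col W Z).image cl →
      ((colored col W Z).filter fun v => cl v = l).card ≤ 2 * Δ := by
    intro Z l hl
    refine (Finset.card_le_card (Finset.filter_subset_filter _ colored_subset)).trans
      (hcov.card_class_le h.deg ?_)
    exact Finset.mem_range.1 (CriticalBlock.classesOf_subset (col := col) hcov Z hl)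
  have hbY := card_le_of_classes hUY (hall Y) Finset.inter_subset_left
  have hbX := card_le_of_classes hUX (hall X) Finset.inter_subset_right
  change (colored col W Y).card ≤ Δ * U.card + 2 * Δ * (classesOf col W cl Y \ U).card at hbY
  change (colored col W X).card ≤ Δ * U.card + 2 * Δ * (classesOf col W cl X \ U).card at hbX
  have hcY : (classesOf col W cl Y \ U).card + U.card = Y.card := by
    rw [← hYcard]
    exact Finset.card_sdiff_add_card_eq_card Finset.inter_subset_left
  have hcX : (classesOf col W cl X \ U).card + Y.card ≤ C.card - 1 := by
    rw [← hYcard, ← Finset.card_union_of_disjoint]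
    · simpa using Finset.card_le_card (Finset.union_subset
        (Finset.sdiff_subset.trans (CriticalBlock.classesOf_subset (col := col) hcov X))
        (CriticalBlock.classesOf_subset (col := col) hcov Y))
    · rw [Finset.disjoint_left]
      intro l hl hl'
      rw [Finset.mem_sdiff] at hl
      exact hl.2 (Finset.mem_inter.2 ⟨hl', hl.1⟩)
  have hpY := h.card_gt Y hYC hYne hYC'
  have hpX := h.card_gt X Finset.sdiff_subset hXne hXC
  set a := (classesOf col W cl Y \ U).card
  set b := (classesOf col W cl X \ U).card
  have hYpos := Finset.card_pos.2 hYne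
  have hXpos := Finset.card_pos.2 hXne
  have hbX' : 2 * Δ * (b + 1) ≤ 2 * Δ * X.card := Nat.mul_le_mul_left _ (by omega)
  rw [Nat.mul_add, Nat.mul_one] at hbX'
  rw [← hcY, Nat.mul_add] at hpY
  -- With no shared class X is too small, and with two or more Y is. With exactly one, each side Z
  -- has at most 2Δ|Z| - Δ vertices, against `h3` for the side with fewer than half of the colours;
  -- oddness excludes a tie.
  rcases Nat.lt_trichotomy U.card 1 with hu | hu | hu
  · obtain hu0 : U.card = 0 := by omega
    rw [hu0, Nat.mul_zero] at hbX
    omega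
  · rw [hu, Nat.mul_one] at hbX hbY hpY
    rcases lt_or_ge (2 * X.card) C.card with hlt | hge
    · have := h3 X Finset.sdiff_subset hXne hlt
      omega
    · obtain ⟨m, hm⟩ := hodd
      have := h3 Y hYC hYne (by omega)
      rw [← hcY, hu, Nat.mul_add] at this
      omega
  · have h4 : Δ * 2 ≤ Δ * U.card := Nat.mul_le_mul_left _ hu
    have h5 : 2 * Δ * U.card = Δ * U.card + Δ * U.card := by ring
    omega

end Blocks


/-! ### Star forests, domination and alternating paths -/

section Domination

variable {V ι : Type*} [Fintype V] [DecidableEq V] [Fintype ι] [DecidableEq ι]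

/-- `J` is a partial independent transversal. -/
def Rainbow (G : SimpleGraph V) (col : V → ι) (J : Finset V) : Prop :=
  G.IsIndepSet (J : Set V) ∧ Set.InjOn col (J : Set V)

variable {G : SimpleGraph V} {col : V → ι} {M : Finset ι}

theorem Rainbow.subset {J K : Finset V} (h : Rainbow G col J) (hK : K ⊆ J) : Rainbow G col K :=
  ⟨h.1.mono (Finset.coe_subset.2 hK), h.2.mono (Finset.coe_subset.2 hK)⟩

theorem Rainbow.insert {J : Finset V} (h : Rainbow G col J) {v : V} (hadj : ∀ u ∈ J, ¬ G.Adj v u)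
    (hcol : ∀ u ∈ J, col u ≠ col v) : Rainbow G col (insert v J) := by
  have hvJ : v ∉ J := fun hv => hcol v hv rfl
  constructor
  · rw [Finset.coe_insert]
    intro a ha b hb hab habadj
    rcases ha with rfl | ha <;> rcases hb with rfl | hb
    · exact hab rfl
    · exact hadj b hb habadj
    · exact hadj a ha habadj.symm
    · exact h.1 ha hb hab habadj
  · rw [Finset.coe_insert, Set.injOn_insert (by simpa using hvJ)]
    refine ⟨h.2, ?_⟩
    rintro ⟨u, hu, he⟩
    exact hcol u hu he

/-- The partial transversals missing exactly the colours in `M` that contain `W` and have no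
neighbour of `X` outside `W`. -/
structure Admissible (G : SimpleGraph V) (col : V → ι) (M : Finset ι) (X W J : Finset V) :
    Prop where
  rainbow : Rainbow G col J
  image : J.image col = Finset.univ \ M
  subset : W ⊆ J
  mem : ∀ x ∈ X, ∀ z ∈ J, G.Adj x z → z ∈ W

/-- The colours missed by the transversal, together with those of `W`. -/
def active (col : V → ι) (M : Finset ι) (W : Finset V) : Finset ι := M ∪ W.image col

theorem mem_active {W : Finset V} {p : ι} :
    p ∈ active col M W ↔ p ∈ M ∨ ∃ w ∈ W, col w = p := by
  simp [active]

/-- A configuration of stars with centres in `X` and leaves in `W`, grown from the colours in `M`. -/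
structure StarForest (G : SimpleGraph V) (col : V → ι) (M : Finset ι) (X W : Finset V)
    (b : ι → ι) (rk : ι → ℕ) : Prop where
  admissible : ∃ J, Admissible G col M X W J
  indep : ∀ x ∈ X, ∀ y ∈ X, ¬ G.Adj x y
  exists_center : ∀ w ∈ W, ∃ x ∈ X, G.Adj x w
  center_unique : ∀ w ∈ W, ∀ x ∈ X, ∀ y ∈ X, G.Adj x w → G.Adj y w → x = y
  exists_leaf : ∀ x ∈ X, ∃ w ∈ W, G.Adj x w
  exchange : ∀ J, Admissible G col M X W J → ∀ w ∈ W, ∀ v, col v = col w →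
    (∀ x ∈ X, ¬ G.Adj x v) → (∀ z ∈ J, ¬ G.Adj v z) → False
  root : ∀ p ∈ M, b p = p
  root_mem : ∀ p ∈ active col M W, b p ∈ M
  center_mem : ∀ x ∈ X, col x ∈ active col M W
  rank : ∀ x ∈ X, ∀ w ∈ W, G.Adj x w → rk (col x) < rk (col w) ∧ b (col w) = b (col x)

variable {X W J : Finset V} {b : ι → ι} {rk : ι → ℕ}

theorem Admissible.card (h : Admissible G col M X W J) : J.card = Fintype.card ι - M.card := by
  rw [← Finset.card_image_of_injOn h.rainbow.2, h.image, Finset.card_univ_sdiff]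

theorem Admissible.col_notMem (h : Admissible G col M X W J) {z : V} (hz : z ∈ J) :
    col z ∉ M := by
  have : col z ∈ J.image col := Finset.mem_image_of_mem _ hz
  rw [h.image, Finset.mem_sdiff] at this
  exact this.2

namespace StarForest

theorem center_notMem (h : StarForest G col M X W b rk) (hJ : Admissible G col M X W J) {x : V}
    (hx : x ∈ X) : x ∉ J := by
  intro hxJ
  obtain ⟨w, hw, hxw⟩ := h.exists_leaf x hx
  exact hJ.rainbow.1 hxJ (hJ.subset hw) hxw.ne hxw

/-- The undominated vertex x becomes a centre, and its neighbours in J become leaves. Minimality of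
their number, over all admissible J, preserves the exchange property. There is at least one
neighbour: otherwise x either extends J or replaces the leaf of its colour, against exchange. -/
theorem exists_insert (h : StarForest G col M X W b rk)
    (hmax : ∀ J, Rainbow G col J → J.card ≤ Fintype.card ι - M.card) {x : V}
    (hx : col x ∈ active col M W) (hxX : ∀ z ∈ X, ¬ G.Adj x z) (hxW : ∀ z ∈ W, ¬ G.Adj x z) :
    x ∉ X ∧ ∃ W' b' rk', StarForest G col M (insert x X) W' b' rk' := by
  have hxnX : x ∉ X := fun hx => by
    obtain ⟨w, hw, hxw⟩ := h.exists_leaf x hx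
    exact hxW w hw hxw
  refine ⟨hxnX, ?_⟩
  obtain ⟨J, hJ, hJmin⟩ : ∃ J, Admissible G col M X W J ∧ ∀ J', Admissible G col M X W J' →
      (nbr G J x).card ≤ (nbr G J' x).card := by
    classical
    obtain ⟨J, hJ, hmin⟩ := Finset.exists_min_image
      (Finset.univ.filter fun J => Admissible G col M X W J) (fun J => (nbr G J x).card)
      (by obtain ⟨J, hJ⟩ := h.admissible; exact ⟨J, by simpa using hJ⟩)
    exact ⟨J, by simpa using hJ, fun J' hJ' => hmin J' (by simpa using hJ')⟩
  set N := nbr G J x with hN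
  have hNJ : ∀ z, z ∈ N ↔ z ∈ J ∧ G.Adj x z := fun z => mem_nbr
  have hNne : N.Nonempty := by
    by_contra hne
    have hnadj : ∀ z ∈ J, ¬ G.Adj x z := fun z hz hxz => hne ⟨z, (hNJ z).2 ⟨hz, hxz⟩⟩
    rcases mem_active.1 hx with hxM | ⟨w, hw, hwx⟩
    · have hcol : ∀ u ∈ J, col u ≠ col x := fun u hu e => hJ.col_notMem hu (e ▸ hxM)
      have h1 := hmax _ (hJ.rainbow.insert hnadj hcol)
      rw [Finset.card_insert_of_notMem fun hxJ => hcol x hxJ rfl, hJ.card] at h1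
      omega
    · exact h.exchange J hJ w hw x hwx.symm (fun z hz hzx => hxX z hz hzx.symm) hnadj
  have hnew : ∀ z ∈ N, col z ∉ active col M W := by
    intro z hz hza
    rw [hNJ] at hz
    rcases mem_active.1 hza with hzM | ⟨w, hw, hwz⟩
    · exact hJ.col_notMem hz.1 hzM
    · have : w = z := hJ.rainbow.2 (hJ.subset hw) hz.1 hwz
      exact hxW w hw (this ▸ hz.2)
  have hact : ∀ p, p ∈ active col M (W ∪ N) ↔ p ∈ active col M W ∨ p ∈ N.image col := by
    intro p
    simp only [mem_active, Finset.mem_union, Finset.mem_image]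
    constructor
    · rintro (h | ⟨w, h | h, e⟩)
      · exact Or.inl (Or.inl h)
      · exact Or.inl (Or.inr ⟨w, h, e⟩)
      · exact Or.inr ⟨w, h, e⟩
    · rintro ((h | ⟨w, h, e⟩) | ⟨w, h, e⟩)
      · exact Or.inl h
      · exact Or.inr ⟨w, Or.inl h, e⟩
      · exact Or.inr ⟨w, Or.inr h, e⟩
  have hold : ∀ p ∈ active col M W, p ∉ N.image col := by
    intro p hp hpN
    obtain ⟨z, hz, rfl⟩ := Finset.mem_image.1 hpN
    exact hnew z hz hp
  have hleaf : ∀ w ∈ W, col w ∈ active col M W := fun w hw => mem_active.2 (Or.inr ⟨w, hw, rfl⟩)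
  have hXN : ∀ y ∈ X, ∀ z ∈ N, ¬ G.Adj y z := by
    intro y hy z hz hyz
    rw [hNJ] at hz
    exact hxW z (hJ.mem y hy z hz.1 hyz) hz.2
  -- The new leaf colours join the block of x, one rank above it.
  refine ⟨W ∪ N, fun p => if p ∈ N.image col then b (col x) else b p,
    fun p => if p ∈ N.image col then rk (col x) + 1 else rk p, ⟨J, hJ.rainbow, hJ.image, ?_, ?_⟩,
    ?_, ?_, ?_, ?_, ?_, ?_, ?_, ?_, ?_⟩
  · exact Finset.union_subset hJ.subset fun z hz => ((hNJ z).1 hz).1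
  · intro y hy z hz hyz
    rw [Finset.mem_union]
    rcases Finset.mem_insert.1 hy with rfl | hy
    · exact Or.inr ((hNJ z).2 ⟨hz, hyz⟩)
    · exact Or.inl (hJ.mem y hy z hz hyz)
  · intro y hy z hz hyz
    rcases Finset.mem_insert.1 hy with rfl | hy' <;> rcases Finset.mem_insert.1 hz with rfl | hz'
    · exact hyz.ne rfl
    · exact hxX z hz' hyz
    · exact hxX y hy' hyz.symm
    · exact h.indep y hy' z hz' hyz
  · intro w hw
    rcases Finset.mem_union.1 hw with hw | hw
    · obtain ⟨y, hy, hyw⟩ := h.exists_center w hw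
      exact ⟨y, Finset.mem_insert_of_mem hy, hyw⟩
    · exact ⟨x, Finset.mem_insert_self _ _, ((hNJ w).1 hw).2⟩
  · intro w hw y hy z hz hyw hzw
    rcases Finset.mem_union.1 hw with hwW | hwN
    · rcases Finset.mem_insert.1 hy with rfl | hy'
      · exact absurd hyw (hxW w hwW)
      rcases Finset.mem_insert.1 hz with rfl | hz'
      · exact absurd hzw (hxW w hwW)
      exact h.center_unique w hwW y hy' z hz' hyw hzw
    · rcases Finset.mem_insert.1 hy with rfl | hy'
      · rcases Finset.mem_insert.1 hz with rfl | hz'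
        · rfl
        · exact absurd hzw (hXN z hz' w hwN)
      · exact absurd hyw (hXN y hy' w hwN)
  · intro y hy
    rcases Finset.mem_insert.1 hy with rfl | hy
    · obtain ⟨z, hz⟩ := hNne
      exact ⟨z, Finset.mem_union_right _ hz, ((hNJ z).1 hz).2⟩
    · obtain ⟨w, hw, hyw⟩ := h.exists_leaf y hy
      exact ⟨w, Finset.mem_union_left _ hw, hyw⟩
  · intro J' hJ' w hw v hvw hvX hvJ
    have hJ'W : Admissible G col M X W J' := by
      refine ⟨hJ'.rainbow, hJ'.image, Finset.subset_union_left.trans hJ'.subset, ?_⟩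
      intro y hy z hz hyz
      rcases Finset.mem_union.1 (hJ'.mem y (Finset.mem_insert_of_mem hy) z hz hyz) with hz' | hz'
      · exact hz'
      · exact absurd hyz (hXN y hy z hz')
    have hvX' : ∀ y ∈ X, ¬ G.Adj y v := fun y hy => hvX y (Finset.mem_insert_of_mem hy)
    by_cases hwW : w ∈ W
    · exact h.exchange J' hJ'W w hwW v hvw hvX' hvJ
    have hwN : w ∈ N := (Finset.mem_union.1 hw).resolve_left hwW
    have hwJ' : w ∈ J' := hJ'.subset hw
    have hcol : ∀ u ∈ J'.erase w, col u ≠ col v := by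
      intro u hu e
      rw [Finset.mem_erase] at hu
      exact hu.1 (hJ'.rainbow.2 hu.2 hwJ' (e.trans hvw))
    -- Exchanging a new leaf w for v would leave x with fewer neighbours than the minimum.
    have hJ'' : Admissible G col M X W (insert v (J'.erase w)) := by
      refine ⟨(hJ'.rainbow.subset (Finset.erase_subset _ _)).insert
        (fun u hu => hvJ u (Finset.mem_of_mem_erase hu)) hcol, ?_, ?_, ?_⟩
      · rw [Finset.image_insert, hvw, ← Finset.image_insert, Finset.insert_erase hwJ', hJ'.image]
      · intro u hu
        exact Finset.mem_insert_of_mem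
          (Finset.mem_erase.2 ⟨fun e => hwW (e ▸ hu), hJ'W.subset hu⟩)
      · intro y hy z hz hyz
        rcases Finset.mem_insert.1 hz with rfl | hz
        · exact absurd hyz (hvX' y hy)
        · exact hJ'W.mem y hy z (Finset.mem_of_mem_erase hz) hyz
    have h1 := hJmin _ hJ''
    have h2 : nbr G (insert v (J'.erase w)) x ⊆ N.erase w := by
      intro z hz
      rw [mem_nbr, Finset.mem_insert, Finset.mem_erase] at hz
      obtain ⟨rfl | ⟨hzw, hzJ⟩, hxz⟩ := hz
      · exact absurd hxz (hvX x (Finset.mem_insert_self _ _))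
      · rcases Finset.mem_union.1 (hJ'.mem x (Finset.mem_insert_self _ _) z hzJ hxz) with hz' | hz'
        · exact absurd hxz (hxW z hz')
        · exact Finset.mem_erase.2 ⟨hzw, hz'⟩
    have h3 := Finset.card_le_card h2
    have h4 := Finset.card_erase_lt_of_mem hwN
    omega
  · intro p hp
    rw [if_neg (hold p (mem_active.2 (Or.inl hp)))]
    exact h.root p hp
  · intro p hp
    split_ifs with hpN
    · exact h.root_mem _ hx
    · exact h.root_mem _ (((hact p).1 hp).resolve_right hpN)
  · intro y hy
    rw [hact]
    rcases Finset.mem_insert.1 hy with rfl | hy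
    · exact Or.inl hx
    · exact Or.inl (h.center_mem y hy)
  · intro y hy w hw hyw
    rcases Finset.mem_union.1 hw with hwW | hwN
    · rcases Finset.mem_insert.1 hy with rfl | hy
      · exact absurd hyw (hxW w hwW)
      · rw [if_neg (hold _ (h.center_mem y hy)), if_neg (hold _ (hleaf w hwW)),
          if_neg (hold _ (h.center_mem y hy)), if_neg (hold _ (hleaf w hwW))]
        exact h.rank y hy w hwW hyw
    · rcases Finset.mem_insert.1 hy with rfl | hy
      · rw [if_neg (hold _ hx), if_pos (Finset.mem_image_of_mem _ hwN), if_neg (hold _ hx),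
          if_pos (Finset.mem_image_of_mem _ hwN)]
        exact ⟨Nat.lt_succ_self _, rfl⟩
      · exact absurd hyw (hXN y hy w hwN)

end StarForest

/-- The star forest can be chosen to dominate all vertices of the active colours. -/
theorem exists_dominating (hmax : ∀ J, Rainbow G col J → J.card ≤ Fintype.card ι - M.card)
    (hI : Rainbow G col J) (himg : J.image col = Finset.univ \ M) :
    ∃ X W b rk, StarForest G col M X W b rk ∧
      ∀ v, col v ∈ active col M W → ∃ z ∈ X ∪ W, G.Adj v z := by
  have h0 : StarForest G col M ∅ ∅ (fun p => p) (fun _ => 0) :=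
    ⟨⟨J, hI, himg, by simp, by simp⟩, by simp, by simp, by simp, by simp, by simp, by simp,
      by simp [active], by simp, by simp⟩
  suffices hs : ∀ m : ℕ, (∃ X W b rk, StarForest G col M X W b rk ∧ m ≤ X.card) ∨
      ∃ X W b rk, StarForest G col M X W b rk ∧
        ∀ v, col v ∈ active col M W → ∃ z ∈ X ∪ W, G.Adj v z by
    rcases hs (Fintype.card V + 1) with ⟨X, W, b, rk, -, hX⟩ | h
    · have := Finset.card_le_univ X
      omega
    · exact h
  intro m
  induction m with
  | zero => exact Or.inl ⟨_, _, _, _, h0, by simp⟩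
  | succ m ih =>
    rcases ih with ⟨X, W, b, rk, h, hX⟩ | h
    · by_cases hd : ∀ v, col v ∈ active col M W → ∃ z ∈ X ∪ W, G.Adj v z
      · exact Or.inr ⟨X, W, b, rk, h, hd⟩
      · push Not at hd
        obtain ⟨v, hv, hvn⟩ := hd
        obtain ⟨hvX, W', b', rk', h'⟩ := h.exists_insert hmax hv
          (fun z hz => hvn z (Finset.mem_union_left _ hz))
          (fun z hz => hvn z (Finset.mem_union_right _ hz))
        refine Or.inl ⟨_, _, _, _, h', ?_⟩
        rw [Finset.card_insert_of_notMem hvX]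
        omega
    · exact Or.inr h

namespace StarForest

theorem card_active (h : StarForest G col M X W b rk) :
    (active col M W).card = M.card + W.card := by
  obtain ⟨J, hJ⟩ := h.admissible
  rw [active, Finset.card_union_of_disjoint,
    Finset.card_image_of_injOn (hJ.rainbow.2.mono (Finset.coe_subset.2 hJ.subset))]
  rw [Finset.disjoint_left]
  intro p hp hpW
  obtain ⟨w, hw, rfl⟩ := Finset.mem_image.1 hpW
  exact hJ.col_notMem (hJ.subset hw) hp

theorem card_centers_le (h : StarForest G col M X W b rk) : X.card ≤ W.card := by
  have hex := h.exists_leaf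
  choose! f hfW hfadj using hex
  refine Finset.card_le_card_of_injOn f hfW fun x hx y hy hxy => ?_
  exact h.center_unique (f x) (hfW x hx) x hx y hy (hfadj x hx) (hxy ▸ hfadj y hy)

/-- With as many centres as leaves, every star is an edge. -/
theorem leaf_unique (h : StarForest G col M X W b rk) (hcard : X.card = W.card) {x w w' : V}
    (hx : x ∈ X) (hw : w ∈ W) (hw' : w' ∈ W) (hxw : G.Adj x w) (hxw' : G.Adj x w') : w = w' := by
  have : Nonempty V := ⟨x⟩
  have hex := h.exists_center
  choose! g hgX hgadj using hex
  have hsurj : Set.SurjOn g (W : Set V) (X : Set V) := by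
    intro y hy
    obtain ⟨u, hu, hyu⟩ := h.exists_leaf y hy
    exact ⟨u, hu, h.center_unique u hu _ (hgX u hu) y hy (hgadj u hu) hyu⟩
  have hinj := Finset.injOn_of_surjOn_of_card_le g (fun u hu => hgX u hu) hsurj hcard.ge
  refine hinj hw hw' ?_
  rw [h.center_unique w hw _ (hgX w hw) x hx (hgadj w hw) hxw,
    h.center_unique w' hw' _ (hgX w' hw') x hx (hgadj w' hw') hxw']

/-- Alternating along the stars below a colour `p` frees this colour. -/
theorem exists_shift (h : StarForest G col M X W b rk) (hJ : Admissible G col M X W J)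
    (hcard : X.card = W.card) : ∀ (m : ℕ) (p : ι), rk p = m → p ∈ active col M W →
    ∀ J₀ ⊆ X ∪ J, Rainbow G col J₀ → (∀ w ∈ W, b (col w) = b p → w ∈ J₀) →
    (∀ z ∈ J₀, col z ≠ b p) → ∃ J₁ ⊆ X ∪ J, Rainbow G col J₁ ∧ J₁.card = J₀.card ∧
      (∀ z ∈ J₁, col z ≠ p) ∧
      ∀ z, ¬ (z ∈ X ∧ b (col z) = b p) → ¬ (z ∈ W ∧ b (col z) = b p ∧ rk (col z) ≤ m) →
        (z ∈ J₁ ↔ z ∈ J₀) := by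
  intro m
  induction m using Nat.strong_induction_on with
  | _ m ih =>
    intro p hpm hp J₀ hJ₀ hR hWJ hfree
    rcases mem_active.1 hp with hpM | ⟨w, hw, rfl⟩
    · rw [h.root p hpM] at hfree
      exact ⟨J₀, hJ₀, hR, rfl, hfree, fun z _ _ => Iff.rfl⟩
    · obtain ⟨x, hx, hxw⟩ := h.exists_center w hw
      obtain ⟨hrk, hb⟩ := h.rank x hx w hw hxw
      -- First free the colour of the centre x, which has smaller rank; then x can replace its only
      -- leaf w. The leaf w is still present, because the earlier shift moved only leaves of smaller
      -- rank.
      obtain ⟨J₁, hJ₁, hR₁, hc₁, hfree₁, hag₁⟩ := ih (rk (col x)) (hpm ▸ hrk) (col x) rfl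
        (h.center_mem x hx) J₀ hJ₀ hR (by rwa [← hb]) (by rwa [← hb])
      rw [← hb] at hag₁
      have hwX : w ∉ X := fun hwX => h.indep x hx w hwX hxw
      have hwJ₁ : w ∈ J₁ := by
        rw [hag₁ w (fun e => hwX e.1) (fun e => by have := e.2.2; omega)]
        exact hWJ w hw rfl
      have hxJ₁ : x ∉ J₁ := fun hx => hfree₁ x hx rfl
      refine ⟨insert x (J₁.erase w), ?_, ?_, ?_, ?_, ?_⟩
      · exact Finset.insert_subset (Finset.mem_union_left _ hx)
          ((Finset.erase_subset _ _).trans hJ₁)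
      · refine (hR₁.subset (Finset.erase_subset _ _)).insert (fun u hu hxu => ?_)
          fun u hu => hfree₁ u (Finset.mem_of_mem_erase hu)
        rw [Finset.mem_erase] at hu
        rcases Finset.mem_union.1 (hJ₁ hu.2) with huX | huJ
        · exact h.indep x hx u huX hxu
        · exact hu.1 (h.leaf_unique hcard hx (hJ.mem x hx u huJ hxu) hw hxu hxw)
      · rw [Finset.card_insert_of_notMem fun hx => hxJ₁ (Finset.mem_of_mem_erase hx),
          Finset.card_erase_add_one hwJ₁, hc₁]
      · intro z hz e
        rcases Finset.mem_insert.1 hz with rfl | hz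
        · rw [e] at hrk; omega
        · rw [Finset.mem_erase] at hz
          exact hz.1 (hR₁.2 hz.2 hwJ₁ e)
      · intro z hz1 hz2
        have hzx : z ≠ x := fun e => hz1 (by rw [e]; exact ⟨hx, hb.symm⟩)
        have hzw : z ≠ w := fun e => hz2 (by rw [e]; exact ⟨hw, rfl, hpm.le⟩)
        rw [Finset.mem_insert, Finset.mem_erase]
        simp only [hzx, hzw, false_or, ne_eq, not_false_eq_true, true_and]
        exact hag₁ z hz1 fun e => hz2 ⟨e.1, e.2.1, by have := e.2.2; omega⟩

/-- The vertices of the active colours that have a neighbour in `J` outside of their own block. -/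
noncomputable def spoiled (G : SimpleGraph V) (col : V → ι) (M : Finset ι) (W J : Finset V)
    (b : ι → ι) : Finset V := by
  classical exact Finset.univ.filter fun v => col v ∈ active col M W ∧
    ∃ z ∈ J, G.Adj v z ∧ ¬ (col z ∈ active col M W ∧ b (col z) = b (col v))

theorem mem_spoiled {v : V} : v ∈ spoiled G col M W J b ↔ col v ∈ active col M W ∧
    ∃ z ∈ J, G.Adj v z ∧ ¬ (col z ∈ active col M W ∧ b (col z) = b (col v)) := by
  simp [spoiled]

/-- A single neighbour z would, by domination, be a leaf in another block. Shifts in the two blocks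
do not interfere: one frees the colour of v, the other that of z and so removes z, after which v can
be added to a maximum transversal. -/
theorem two_le_of_spoiled (h : StarForest G col M X W b rk) (hJ : Admissible G col M X W J)
    (hcard : X.card = W.card)
    (hmax : ∀ J, Rainbow G col J → J.card ≤ Fintype.card ι - M.card)
    (hdom : ∀ v, col v ∈ active col M W → ∃ z ∈ X ∪ W, G.Adj v z) {v : V}
    (hv : v ∈ spoiled G col M W J b) : 2 ≤ (nbr G (X ∪ J) v).card := by
  rw [mem_spoiled] at hv
  obtain ⟨hvY, z, hzJ, hvz, hzb⟩ := hv
  by_contra hlt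
  have huniq : ∀ u ∈ X ∪ J, G.Adj v u → u = z := by
    intro u hu hvu
    by_contra hne
    exact hlt (Finset.one_lt_card.2 ⟨u, mem_nbr.2 ⟨hu, hvu⟩, z,
      mem_nbr.2 ⟨Finset.mem_union_right _ hzJ, hvz⟩, hne⟩)
  have hzW : z ∈ W := by
    obtain ⟨u, hu, hvu⟩ := hdom v hvY
    rcases Finset.mem_union.1 hu with huX | huW
    · have := huniq u (Finset.mem_union_left _ huX) hvu
      exact absurd hzJ (h.center_notMem hJ (this ▸ huX))
    · exact huniq u (Finset.mem_union_right _ (hJ.subset huW)) hvu ▸ huW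
  have hzY : col z ∈ active col M W := mem_active.2 (Or.inr ⟨z, hzW, rfl⟩)
  have hbne : b (col z) ≠ b (col v) := fun e => hzb ⟨hzY, e⟩
  have hMfree : ∀ p ∈ active col M W, ∀ u ∈ J, col u ≠ b p := fun p hp u hu e =>
    hJ.col_notMem hu (e ▸ h.root_mem p hp)
  obtain ⟨J₁, hJ₁, hR₁, hc₁, hfree₁, hag₁⟩ := h.exists_shift hJ hcard _ (col v) rfl hvY J
    Finset.subset_union_right hJ.rainbow (fun w hw _ => hJ.subset hw) (hMfree _ hvY)
  have hWX : ∀ w ∈ W, w ∉ X := fun w hw hwX => h.center_notMem hJ hwX (hJ.subset hw)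
  obtain ⟨J₂, hJ₂, hR₂, hc₂, hfree₂, hag₂⟩ := h.exists_shift hJ hcard _ (col z) rfl hzY J₁ hJ₁ hR₁
    (fun w hw hwb => (hag₁ w (fun e => hWX w hw e.1) (fun e => hbne (hwb.symm.trans e.2.1))).2
      (hJ.subset hw))
    (fun u hu e => by
      have hbu : b (col u) = b (col z) := by rw [e, h.root _ (h.root_mem _ hzY)]
      have huJ : u ∈ J := (hag₁ u (fun h' => hbne (hbu.symm.trans h'.2))
        (fun h' => hbne (hbu.symm.trans h'.2.1))).1 hu
      exact hMfree _ hzY u huJ e)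
  have hfreev : ∀ u ∈ J₂, col u ≠ col v := by
    intro u hu e
    refine hfree₁ u ((hag₂ u (fun h' => hbne ?_) (fun h' => hbne ?_)).1 hu) e
    · rw [← h'.2, e]
    · rw [← h'.2.1, e]
  have hnadj : ∀ u ∈ J₂, ¬ G.Adj v u := by
    intro u hu hvu
    have := huniq u (hJ₂ hu) hvu
    exact hfree₂ u hu (by rw [this])
  have h1 := hmax _ (hR₂.insert hnadj hfreev)
  rw [Finset.card_insert_of_notMem fun hv => hfreev v hv rfl, hc₂, hc₁, hJ.card] at h1
  omega

/-- The active colours in the block of `β`. -/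
def block (col : V → ι) (M : Finset ι) (W : Finset V) (b : ι → ι) (β : ι) : Finset ι :=
  (active col M W).filter fun p => b p = β

/-- Unspoiled vertices of the block have no neighbours in J outside the block, so such a transversal
could replace the block's part of J, gaining the missed colour β. -/
theorem not_fullIT_block (h : StarForest G col M X W b rk) (hJ : Admissible G col M X W J)
    (hmax : ∀ J, Rainbow G col J → J.card ≤ Fintype.card ι - M.card) {β : ι} (hβ : β ∈ M) :
    ¬ FullIT G col (colored col Finset.univ (block col M W b β) \ spoiled G col M W J b)
      (block col M W b β) := by
  rintro ⟨K, hKW, hK, hinj, himg⟩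
  have hKm : ∀ v ∈ K, col v ∈ block col M W b β ∧ v ∉ spoiled G col M W J b := by
    intro v hv
    have := hKW hv
    rw [Finset.mem_sdiff, mem_colored] at this
    exact ⟨this.1.2, this.2⟩
  have hrest : ∀ z ∈ J \ colored col J (block col M W b β), z ∈ J ∧ col z ∉ block col M W b β := by
    intro z hz
    rw [Finset.mem_sdiff, mem_colored] at hz
    tauto
  have hcross : ∀ v ∈ K, ∀ z ∈ J \ colored col J (block col M W b β), ¬ G.Adj v z := by
    intro v hv z hz hvz
    obtain ⟨h1, h2⟩ := hKm v hv
    obtain ⟨h3, h4⟩ := hrest z hz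
    rw [block, Finset.mem_filter] at h1 h4
    exact h2 (mem_spoiled.2 ⟨h1.1, z, h3, hvz, fun e => h4 ⟨e.1, e.2.trans h1.2⟩⟩)
  have hR : Rainbow G col (K ∪ J \ colored col J (block col M W b β)) := by
    constructor
    · intro u hu v hv huv hadj
      rw [Finset.mem_coe, Finset.mem_union] at hu hv
      rcases hu with hu | hu <;> rcases hv with hv | hv
      · exact hK hu hv huv hadj
      · exact hcross u hu v hv hadj
      · exact hcross v hv u hu hadj.symm
      · exact hJ.rainbow.1 (hrest u hu).1 (hrest v hv).1 huv hadj
    · intro u hu v hv huv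
      rw [Finset.mem_coe, Finset.mem_union] at hu hv
      rcases hu with hu | hu <;> rcases hv with hv | hv
      · exact hinj hu hv huv
      · exact absurd (huv ▸ (hKm u hu).1) (hrest v hv).2
      · exact absurd (huv ▸ (hKm v hv).1) (hrest u hu).2
      · exact hJ.rainbow.2 (hrest u hu).1 (hrest v hv).1 huv
  have hβb : β ∈ block col M W b β :=
    Finset.mem_filter.2 ⟨mem_active.2 (Or.inl hβ), h.root β hβ⟩
  have h1 := hmax _ hR
  have h2 : insert β (Finset.univ \ M) ⊆
      (K ∪ J \ colored col J (block col M W b β)).image col := by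
    intro p hp
    rw [Finset.image_union, himg, Finset.mem_union]
    rcases Finset.mem_insert.1 hp with rfl | hp
    · exact Or.inl hβb
    · by_cases hpb : p ∈ block col M W b β
      · exact Or.inl hpb
      · rw [← hJ.image, Finset.mem_image] at hp
        obtain ⟨z, hz, rfl⟩ := hp
        refine Or.inr (Finset.mem_image_of_mem _ ?_)
        rw [Finset.mem_sdiff, mem_colored]
        exact ⟨hz, fun e => hpb e.2⟩
  have h3 := (Finset.card_le_card h2).trans Finset.card_image_le
  rw [Finset.card_insert_of_notMem (by simp [hβ]), Finset.card_univ_sdiff] at h3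
  omega

end StarForest

end Domination


/-! ### Deletion bounds and double counting -/

section Counting

variable {V ι : Type*} [Fintype V] [DecidableEq V] [DecidableEq ι]
  {G : SimpleGraph V} {col : V → ι} {Δ n : ℕ}

theorem mul_card_le_colored (hn : ∀ i, n ≤ (Finset.univ.filter fun v => col v = i).card)
    (Z : Finset ι) : n * Z.card ≤ (colored col Finset.univ Z).card := by
  rw [Finset.card_eq_sum_card_fiberwise (f := col) (t := Z) fun v hv => (mem_colored.1 hv).2,
    mul_comm]
  refine Finset.card_nsmul_le_sum _ _ _ fun i hi => (hn i).trans (Finset.card_le_card fun v hv => ?_)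
  simp only [Finset.mem_filter, Finset.mem_univ, true_and] at hv
  simp [mem_colored, hv, hi]

/-- A lower bound for the number `u` of vertices that must be deleted from the colour classes in
`C`, of size at least `n`, to destroy all independent transversals. -/
theorem deletion_bound (hproper : ∀ u v, G.Adj u v → col u ≠ col v) {W : Finset V}
    (hdeg : ∀ v ∈ W, (nbr G W v).card ≤ Δ) {C : Finset ι} (hmem : ∀ v ∈ W, col v ∈ C) {u q : ℕ}
    (hlow : ∀ Z ⊆ C, n * Z.card ≤ (colored col W Z).card + u) (hno : ¬ FullIT G col W C)
    (hq : Odd q) (hq3 : 3 ≤ q) {t : ℤ} (hn : (n : ℤ) = 2 * Δ - t) (ht : 0 ≤ t)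
    (hsmall : t * (q ^ 2 - 1) < 2 * Δ * q) (hlarge : 2 * (Δ : ℤ) ≤ q * t) :
    (2 * Δ - (q - 1) * t) * (1 + q - C.card) ≤ 2 * (u : ℤ) := by
  have hq3' : (3 : ℤ) ≤ q := by exact_mod_cast hq3
  have ha : 0 < 2 * (Δ : ℤ) - (q - 1) * t := by
    by_contra hcon
    have h1 : t * ((q : ℤ) ^ 2 - 1) = ((q - 1) * t) * (q + 1) := by ring
    have h2 : 2 * (Δ : ℤ) * (q + 1) ≤ ((q - 1) * t) * (q + 1) :=
      mul_le_mul_of_nonneg_right (by linarith) (by linarith)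
    have h3 : (0 : ℤ) ≤ Δ := by positivity
    linarith
  have hlow' : ∀ Z ⊆ C, (2 * (Δ : ℤ) - t) * Z.card ≤ (colored col W Z).card + u := by
    intro Z hZ
    rw [← hn]
    exact_mod_cast hlow Z hZ
  have hu : (0 : ℤ) ≤ u := by positivity
  -- The general bound, useful only below q: for |C| = q its left side is at most 0 by `hlarge`.
  have hbound : 2 * (Δ : ℤ) - t * C.card ≤ u := by
    obtain ⟨Z, hZC, hZ, hle⟩ := exists_card_colored_le hdeg hno
    have h1 := hlow' Z hZC
    have hpos := Finset.card_pos.2 hZ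
    have h2 : ((colored col W Z).card : ℤ) ≤ 2 * Δ * (Z.card - 1) := by
      zify [hpos] at hle
      exact hle
    have h3 : t * (Z.card : ℤ) ≤ t * C.card :=
      mul_le_mul_of_nonneg_left (by exact_mod_cast Finset.card_le_card hZC) ht
    linarith
  -- The bound to prove is linear in |C|. It agrees with `hbound` at q-1, lies below it for smaller
  -- |C|, and vanishes at q+1. At q it asks for half the value at q-1, which is what `fullIT_of_odd`
  -- supplies.
  rcases lt_trichotomy C.card q with hc | hc | hc
  · have hc' : (C.card : ℤ) + 1 ≤ q := by exact_mod_cast hc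
    have h1 : 0 ≤ ((q : ℤ) - C.card - 1) * (2 * t - (2 * Δ - (q - 1) * t)) :=
      mul_nonneg (by linarith) (by linarith)
    have h2 : (2 * Δ - (q - 1) * t) * (1 + q - C.card) =
      2 * (2 * (Δ : ℤ) - t * C.card) -
        ((q : ℤ) - C.card - 1) * (2 * t - (2 * Δ - (q - 1) * t)) := by ring
    linarith
  · rw [hc]
    by_contra hcon
    have hcon' : 2 * (u : ℤ) < 2 * Δ - (q - 1) * t := by linarith
    refine hno (fullIT_of_odd hproper hdeg (hc ▸ hq) (hc ▸ hq3) hmem ?_ ?_ ?_)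
    · intro Z hZC hZ hne
      have h1 := hlow' Z hZC
      have h2 : Z.card < q := hc ▸ Finset.card_lt_card (hZC.ssubset_of_ne hne)
      have h3 : t * (Z.card : ℤ) ≤ t * (q - 1) :=
        mul_le_mul_of_nonneg_left (by have : (Z.card : ℤ) + 1 ≤ q := by exact_mod_cast h2
                                      linarith) ht
      zify
      linarith
    · have h1 := hlow' C subset_rfl
      have h2 : ((colored col W C).card : ℤ) ≤ W.card := by
        exact_mod_cast Finset.card_le_card (colored_subset (col := col) (W := W) (S := C))
      have h3 : ((q : ℤ) + 1) * t ≤ 3 * Δ := by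
        by_contra h4
        have h5 : (3 * (Δ : ℤ)) * (q - 1) ≤ ((q + 1) * t) * (q - 1) :=
          mul_le_mul_of_nonneg_right (by linarith) (by linarith)
        have h6 : (0 : ℤ) ≤ Δ * (q - 3) := mul_nonneg (by positivity) (by linarith)
        have h7 : t * ((q : ℤ) ^ 2 - 1) = ((q + 1) * t) * (q - 1) := by ring
        linarith
      rw [hc] at h1 ⊢
      zify [show 1 ≤ q by omega]
      linarith
    · intro Z hZC hZ hlt
      have h1 := hlow' Z hZC
      rw [hc] at hlt
      have h3 : t * (2 * (Z.card : ℤ)) ≤ t * (q - 1) :=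
        mul_le_mul_of_nonneg_left
          (by have : 2 * (Z.card : ℤ) + 1 ≤ q := by exact_mod_cast hlt
              linarith) ht
      zify
      linarith
  · have hc' : (q : ℤ) + 1 ≤ C.card := by exact_mod_cast hc
    have := mul_nonneg ha.le (show (0 : ℤ) ≤ C.card - (q + 1) by linarith)
    linarith

theorem card_le_of_dominated {S T : Finset V} (hdeg : ∀ v, (nbr G Finset.univ v).card ≤ Δ)
    (h : ∀ v ∈ S, ∃ z ∈ T, G.Adj v z) : S.card ≤ Δ * T.card := by
  rw [mul_comm]
  refine (Finset.card_le_card fun v hv => ?_).trans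
    (Finset.card_biUnion_le_card_mul T (nbr G Finset.univ) Δ fun z _ => hdeg z)
  obtain ⟨z, hz, hvz⟩ := h v hv
  exact Finset.mem_biUnion.2 ⟨z, hz, mem_nbr.2 ⟨Finset.mem_univ _, hvz.symm⟩⟩

theorem card_add_card_le_of_dominated {S S' T : Finset V}
    (hdeg : ∀ v, (nbr G Finset.univ v).card ≤ Δ) (hS : S' ⊆ S)
    (h : ∀ v ∈ S, ∃ z ∈ T, G.Adj v z) (h' : ∀ v ∈ S', 2 ≤ (nbr G T v).card) :
    S.card + S'.card ≤ Δ * T.card := by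
  classical
  have h1 : ∑ v ∈ S, (nbr G T v).card = ∑ z ∈ T, (nbr G S z).card := by
    have := Finset.sum_card_bipartiteAbove_eq_sum_card_bipartiteBelow G.Adj (s := S) (t := T)
    refine Eq.trans (Finset.sum_congr rfl fun v _ => ?_)
      (this.trans (Finset.sum_congr rfl fun z _ => ?_))
    · congr 1
    · congr 1; ext v; simp [mem_nbr, Finset.mem_bipartiteBelow, G.adj_comm]
  have h2 : ∑ z ∈ T, (nbr G S z).card ≤ Δ * T.card := by
    rw [mul_comm]
    exact Finset.sum_le_card_nsmul _ _ _ fun z _ =>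
      (Finset.card_le_card (nbr_mono le_rfl (Finset.subset_univ S) z)).trans (hdeg z)
  have h3 : S.card + S'.card = ∑ v ∈ S, (1 + if v ∈ S' then 1 else 0) := by
    rw [Finset.sum_add_distrib, Finset.card_eq_sum_ones S, ← Finset.sum_filter,
      Finset.filter_mem_eq_inter, Finset.inter_eq_right.2 hS, Finset.card_eq_sum_ones S']
  rw [h3]
  refine (Finset.sum_le_sum fun v hv => ?_).trans (h1.trans_le h2)
  split_ifs with hvS
  · exact h' v hvS
  · obtain ⟨z, hz, hvz⟩ := h v hv
    exact Finset.card_pos.2 ⟨z, mem_nbr.2 ⟨hz, hvz⟩⟩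

end Counting

/-! ### Comparing the two estimates for spoiled vertices -/

section Main

variable {V ι : Type*} [Fintype V] [DecidableEq V] [Fintype ι] [DecidableEq ι]
  {G : SimpleGraph V} {col : V → ι} {Δ n : ℕ}

theorem StarForest.deletion_count {M : Finset ι} {X W J : Finset V} {b : ι → ι} {rk : ι → ℕ}
    (h : StarForest G col M X W b rk) (hJ : Admissible G col M X W J)
    (hmax : ∀ J, Rainbow G col J → J.card ≤ Fintype.card ι - M.card)
    (hproper : ∀ u v, G.Adj u v → col u ≠ col v)
    (hdeg : ∀ v, (nbr G Finset.univ v).card ≤ Δ)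
    (hn : ∀ i, n ≤ (Finset.univ.filter fun v => col v = i).card)
    {q : ℕ} (hq : Odd q) (hq3 : 3 ≤ q) {t : ℤ} (hnt : (n : ℤ) = 2 * Δ - t) (ht : 0 ≤ t)
    (hsmall : t * (q ^ 2 - 1) < 2 * Δ * q) (hlarge : 2 * (Δ : ℤ) ≤ q * t) :
    (2 * Δ - (q - 1) * t) * (M.card * (1 + q) - (active col M W).card) ≤
      2 * ((StarForest.spoiled G col M W J b).card : ℤ) := by
  set U := StarForest.spoiled G col M W J b with hU
  have hsumU : U.card = ∑ β ∈ M, (U.filter fun v => b (col v) = β).card :=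
    Finset.card_eq_sum_card_fiberwise fun v hv =>
      h.root_mem _ (StarForest.mem_spoiled.1 hv).1
  have hsumY : (active col M W).card = ∑ β ∈ M, (StarForest.block col M W b β).card :=
    Finset.card_eq_sum_card_fiberwise fun p hp => h.root_mem p hp
  rw [hsumU, hsumY]
  push_cast
  rw [Finset.mul_sum, ← nsmul_eq_mul, ← Finset.sum_const, ← Finset.sum_sub_distrib,
    Finset.mul_sum]
  refine Finset.sum_le_sum fun β hβ => ?_
  refine deletion_bound hproper (fun v _ => (Finset.card_le_card
    (nbr_mono le_rfl (Finset.subset_univ _) v)).trans (hdeg v)) (fun v hv => ?_) (fun Z hZ => ?_)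
    (h.not_fullIT_block hJ hmax hβ) hq hq3 hnt ht hsmall hlarge
  · exact (mem_colored.1 (Finset.mem_sdiff.1 hv).1).2
  · refine (mul_card_le_colored hn Z).trans ((Finset.card_le_card fun v hv => ?_).trans
      (Finset.card_union_le _ _))
    rw [mem_colored] at hv
    have hvb := hZ hv.2
    rw [Finset.mem_union, mem_colored, Finset.mem_sdiff, mem_colored, Finset.mem_filter]
    by_cases hvU : v ∈ U
    · exact Or.inr ⟨hvU, (Finset.mem_filter.1 hvb).2⟩
    · exact Or.inl ⟨⟨⟨hv.1, hvb⟩, hvU⟩, hv.2⟩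

/-- The integral form of the bound on the size of the parts. -/
theorem part_size_bound {d q : ℕ} (hr : Fintype.card ι = q * (d + 1)) (hq : Odd q) (hq3 : 3 ≤ q)
    (hproper : ∀ u v, G.Adj u v → col u ≠ col v)
    (hdeg : ∀ v, (nbr G Finset.univ v).card ≤ Δ)
    (hn : ∀ i, n ≤ (Finset.univ.filter fun v => col v = i).card)
    (hno : ∀ J, Rainbow G col J → J.card + d + 1 ≤ Fintype.card ι)
    (h1 : 4 * Δ * Fintype.card ι < 2 * n * Fintype.card ι + Δ * (4 * d + 5)) :
    2 * (Δ : ℤ) * q ≤ (2 * Δ - n) * (q ^ 2 - 1) := by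
  by_contra hsmall
  rw [not_le] at hsmall
  obtain ⟨I, hI, hImax⟩ : ∃ I, Rainbow G col I ∧ ∀ J, Rainbow G col J → J.card ≤ I.card := by
    classical
    obtain ⟨I, hI, hmax⟩ := Finset.exists_max_image
      (Finset.univ.filter fun J => Rainbow G col J) Finset.card
      ⟨∅, Finset.mem_filter.2 ⟨Finset.mem_univ _, by simp [Rainbow]⟩⟩
    exact ⟨I, by simpa using hI, fun J hJ => hmax J (by simpa using hJ)⟩
  set M := Finset.univ \ I.image col with hM
  have hMc : M.card = Fintype.card ι - I.card := by
    rw [hM, Finset.card_univ_sdiff, Finset.card_image_of_injOn hI.2]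
  have himg : I.image col = Finset.univ \ M := by rw [hM, Finset.sdiff_sdiff_eq_self (by simp)]
  have hIr := hno I hI
  have hmax : ∀ J, Rainbow G col J → J.card ≤ Fintype.card ι - M.card := fun J hJ => by
    have := hImax J hJ
    omega
  obtain ⟨X, W, b, rk, h, hdom⟩ := exists_dominating hmax hI himg
  obtain ⟨J, hJ⟩ := h.admissible
  have hy := h.card_active
  have hXW := h.card_centers_le
  have hYr := Finset.card_le_univ (active col M W)
  have hJc := hJ.card
  set Y := active col M W with hY
  set r := Fintype.card ι with hrdef
  have hsize := mul_card_le_colored hn Y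
  have hdom1 := card_le_of_dominated hdeg (S := colored col Finset.univ Y) (T := X ∪ W)
    fun v hv => hdom v (mem_colored.1 hv).2
  have hXWc := Finset.card_union_le X W
  have hdom2 : n * Y.card ≤ Δ * (X.card + W.card) :=
    hsize.trans (hdom1.trans (Nat.mul_le_mul_left _ hXWc))
  have hdom2' : (n : ℤ) * Y.card ≤ Δ * (X.card + W.card) := by exact_mod_cast hdom2
  have h1' : 4 * (Δ : ℤ) * r < 2 * n * r + Δ * (4 * d + 5) := by exact_mod_cast h1
  have hyz : (Y.card : ℤ) = M.card + W.card := by exact_mod_cast hy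
  have hYr' : (Y.card : ℤ) ≤ r := by exact_mod_cast hYr
  have hΔ0 : (0 : ℤ) ≤ Δ := by positivity
  obtain ⟨t, hnt⟩ : ∃ t : ℤ, (n : ℤ) = 2 * Δ - t := ⟨2 * Δ - n, by ring⟩
  rw [hnt] at hdom2' h1' hsmall
  have hMpos : d + 1 ≤ M.card := by omega
  have hMpos' : (d : ℤ) + 1 ≤ M.card := by exact_mod_cast hMpos
  have hXW' : (X.card : ℤ) ≤ W.card := by exact_mod_cast hXW
  have hWpos : (0 : ℤ) ≤ W.card := Int.natCast_nonneg _
  have hd0 : (0 : ℤ) ≤ d := by positivity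
  have hty : (Δ : ℤ) * (2 * Y.card - X.card - W.card) ≤ t * Y.card := by linarith
  have htpos : 0 ≤ t := by
    by_contra hneg
    have h2 : 0 ≤ (Δ : ℤ) * (2 * Y.card - X.card - W.card) := mul_nonneg hΔ0 (by linarith)
    have h3 : t * (Y.card : ℤ) < 0 := mul_neg_of_neg_of_pos (by linarith) (by linarith)
    linarith
  have htr : t * (Y.card : ℤ) ≤ t * r := mul_le_mul_of_nonneg_left hYr' htpos
  -- By `h1` the left side, multiplied by Δ, is less than Δ(4d+5)/2, and it is an integer. It equals
  -- 2|M| + |W| - |X| ≥ 2(d+1), so both inequalities behind this are equalities.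
  have hdef : 2 * (Y.card : ℤ) - X.card - W.card ≤ 2 * d + 2 := by
    by_contra hcon
    have h2 : (Δ : ℤ) * (2 * d + 3) ≤ Δ * (2 * Y.card - X.card - W.card) :=
      mul_le_mul_of_nonneg_left (by linarith [Int.add_one_le_of_lt (not_le.1 hcon)]) hΔ0
    linarith
  have hMd : M.card = d + 1 := by omega
  have hcard : X.card = W.card := by omega
  have hWY : ∀ v ∈ colored col Finset.univ Y, ∃ z ∈ X ∪ J, G.Adj v z := by
    intro v hv
    obtain ⟨z, hz, hvz⟩ := hdom v (mem_colored.1 hv).2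
    exact ⟨z, Finset.union_subset_union_right hJ.subset hz, hvz⟩
  have hcount := card_add_card_le_of_dominated hdeg (S := colored col Finset.univ Y)
    (S' := StarForest.spoiled G col M W J b) (T := X ∪ J)
    (fun v hv => mem_colored.2 ⟨Finset.mem_univ _, (StarForest.mem_spoiled.1 hv).1⟩) hWY
    fun v hv => h.two_le_of_spoiled hJ hcard hmax hdom hv
  have hXJ := Finset.card_union_le X J
  have hcount' : n * Y.card + (StarForest.spoiled G col M W J b).card ≤
      Δ * (X.card + J.card) :=
    (Nat.add_le_add_right hsize _).trans (hcount.trans (Nat.mul_le_mul_left _ hXJ))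
  have hcountz : (2 * (Δ : ℤ) - t) * Y.card + (StarForest.spoiled G col M W J b).card ≤
      Δ * (X.card + J.card) := by
    rw [← hnt]; exact_mod_cast hcount'
  have hrz : (r : ℤ) = q * (d + 1) := by exact_mod_cast hr
  have hXz : (X.card : ℤ) = Y.card - (d + 1) := by rw [hcard, hyz, hMd]; push_cast; ring
  have hJz : (J.card : ℤ) = r - (d + 1) := by
    have : J.card + (d + 1) = r := by omega
    rw [← this]; push_cast; ring
  have hty2 : 2 * (Δ : ℤ) * (d + 1) ≤ t * Y.card := by
    rw [show (W.card : ℤ) = X.card by rw [hcard], hXz] at hty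
    linarith
  have hdpos : (0 : ℤ) < d + 1 := by linarith
  have hlarge : 2 * (Δ : ℤ) ≤ q * t := by
    refine le_of_mul_le_mul_right ?_ hdpos
    rw [hrz] at htr
    linarith
  have hsmall' : t * ((q : ℤ) ^ 2 - 1) < 2 * Δ * q := by
    linarith [hsmall]
  have hdel := h.deletion_count hJ hmax hproper hdeg hn hq hq3 hnt htpos hsmall' hlarge
  rw [hMd] at hdel
  push_cast at hdel
  rw [hXz, hJz] at hcountz
  have hq3' : (0 : ℤ) ≤ q - 3 := by
    have : (3 : ℤ) ≤ q := by exact_mod_cast hq3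
    linarith
  -- Eliminating the number of spoiled vertices from `hcountz` and `hdel` leaves (q-3)t|Y| + 6Δ(d+1)
  -- ≤ t(q²-1)(d+1). As q ≥ 3, |Y| can be eliminated by t|Y| ≥ 2Δ(d+1).
  have hrho := mul_nonneg hq3' (sub_nonneg.2 hty2)
  rw [hrz] at hcountz
  have hfin : (2 * (Δ : ℤ) * q) * (d + 1) ≤ (t * (q ^ 2 - 1)) * (d + 1) := by
    linarith
  exact absurd (le_of_mul_le_mul_right hfin hdpos) (not_le.2 hsmall')

end Main


/-! ### Existence of the extremal value and passage to real numbers -/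

theorem degree_completeBipartiteGraph (Δ : ℕ)
    [DecidableRel (completeBipartiteGraph (Fin Δ) (Fin Δ)).Adj] (v : Fin Δ ⊕ Fin Δ) :
    (completeBipartiteGraph (Fin Δ) (Fin Δ)).degree v = Δ := by
  rw [← SimpleGraph.card_neighborFinset_eq_degree]
  rcases v with i | i
  · have : (completeBipartiteGraph (Fin Δ) (Fin Δ)).neighborFinset (Sum.inl i) =
        Finset.univ.map Function.Embedding.inr := by
      ext (j | j) <;> simp
    rw [this, Finset.card_map, Finset.card_univ, Fintype.card_fin]
  · have : (completeBipartiteGraph (Fin Δ) (Fin Δ)).neighborFinset (Sum.inr i) =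
        Finset.univ.map Function.Embedding.inl := by
      ext (j | j) <;> simp
    rw [this, Finset.card_map, Finset.card_univ, Fintype.card_fin]

/-- Parts may be empty when n = 0, so the complete bipartite graph with sides of size Δ serves: it
uses two parts, while the transversal needs at least three. -/
theorem zero_mem_constructionSizes {r D Δ : ℕ} (hr : 2 ≤ r) (hD : D + 2 ≤ r) :
    0 ∈ constructionSizes r D Δ := by
  classical
  refine ⟨Fin Δ ⊕ Fin Δ, inferInstance, completeBipartiteGraph (Fin Δ) (Fin Δ), inferInstance,
    SimpleGraph.Coloring.mk (Sum.elim (fun _ => ⟨0, by omega⟩) (fun _ => ⟨1, by omega⟩)) ?_,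
    by simp, ?_, ?_⟩
  · rintro (i | i) (j | j) h <;> simp at h ⊢
  · rcases Nat.eq_zero_or_pos Δ with rfl | hΔ
    · exact Nat.le_zero.1
        (SimpleGraph.maxDegree_le_of_forall_degree_le _ 0 fun v => v.elim Fin.elim0 Fin.elim0)
    · have : Nonempty (Fin Δ ⊕ Fin Δ) := ⟨Sum.inl ⟨0, hΔ⟩⟩
      exact SimpleGraph.IsRegularOfDegree.maxDegree_eq _ fun v => degree_completeBipartiteGraph Δ v
  · rintro ⟨S, -, hinj, hcard⟩
    have h1 := Finset.card_le_card_of_injOn (t := {⟨0, by omega⟩, ⟨1, by omega⟩}) _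
      (by rintro (i | i) - <;> simp [SimpleGraph.Coloring.mk]) hinj
    have h2 := h1.trans Finset.card_le_two
    omega

theorem le_of_mem_constructionSizes {r d q Δ n : ℕ} (hr : r = q * (d + 1)) (hq3 : 3 ≤ q)
    (hq : Odd q) (hn : n ∈ constructionSizes r (d + 1) Δ) :
    (n : ℝ) ≤ max (2 * (Δ : ℝ) * (1 - (4 * (d : ℝ) + 5) / (4 * (r : ℝ))))
        (2 * (Δ : ℝ) * (1 - (q : ℝ) / ((q : ℝ) ^ 2 - 1))) := by
  obtain ⟨V, _, G, _, c, hsize, hmaxdeg, hno⟩ := hn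
  classical
  by_contra hcon
  rw [not_le, max_lt_iff] at hcon
  obtain ⟨hc1, hc2⟩ := hcon
  have hq3' : (3 : ℝ) ≤ q := by exact_mod_cast hq3
  have hrpos : (0 : ℝ) < r := by
    rw [hr]; push_cast; positivity
  have hrd : d + 1 ≤ r := by rw [hr]; nlinarith
  have h1 : 4 * Δ * Fintype.card (Fin r) < 2 * n * Fintype.card (Fin r) + Δ * (4 * d + 5) := by
    rw [Fintype.card_fin]
    have h : 2 * (Δ : ℝ) * (1 - (4 * (d : ℝ) + 5) / (4 * (r : ℝ))) * (2 * r) < n * (2 * r) :=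
      mul_lt_mul_of_pos_right hc1 (by positivity)
    have e : 2 * (Δ : ℝ) * (1 - (4 * (d : ℝ) + 5) / (4 * (r : ℝ))) * (2 * r) =
        4 * Δ * r - Δ * (4 * d + 5) := by
      field_simp
      ring
    rw [e] at h
    have h' : 4 * (Δ : ℝ) * r < 2 * n * r + Δ * (4 * d + 5) := by linarith
    exact_mod_cast h'
  have h2 := part_size_bound (G := G) (col := c) (Δ := Δ) (n := n) (d := d) (q := q)
    (by rw [Fintype.card_fin, hr]) hq hq3 (fun u v huv => c.valid huv) (fun v => ?_) (fun i => ?_)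
    (fun J hJ => ?_) h1
  · have h2' : 2 * (Δ : ℝ) * q ≤ (2 * Δ - n) * ((q : ℝ) ^ 2 - 1) := by exact_mod_cast h2
    have hpos : (0 : ℝ) < (q : ℝ) ^ 2 - 1 := by nlinarith
    have h := mul_lt_mul_of_pos_right hc2 hpos
    have e : 2 * (Δ : ℝ) * (1 - (q : ℝ) / ((q : ℝ) ^ 2 - 1)) * ((q : ℝ) ^ 2 - 1) =
        2 * Δ * ((q : ℝ) ^ 2 - 1) - 2 * Δ * q := by
      field_simp
    rw [e] at h
    linarith
  · rw [← hmaxdeg]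
    refine le_trans (Finset.card_le_card fun w hw => ?_) (G.degree_le_maxDegree v)
    rw [mem_nbr] at hw
    simpa using hw.2
  · refine (hsize i).trans_eq ?_
    rw [← Set.ncard_coe_finset]
    congr 1
    ext v
    simp [SimpleGraph.Coloring.colorClass]
  · rw [Fintype.card_fin]
    by_contra hlt
    -- Only transversals of size exactly r - d are excluded, so a larger one is cut down.
    obtain ⟨S, hSJ, hS⟩ := Finset.exists_subset_card_eq (s := J) (n := r + 1 - (d + 1)) (by omega)
    obtain ⟨hS1, hS2⟩ := hJ.subset hSJ
    exact hno ⟨S, hS1, hS2, hS⟩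

theorem theorem1p3 (r d q Δ : ℕ) (hr : r = q * (d + 1)) (hq3 : 3 ≤ q) (hq : Odd q) :
    IsGreatest (constructionSizes r (d + 1) Δ) (extremalSize r (d + 1) Δ) ∧
    (extremalSize r (d + 1) Δ : ℝ) ≤
      max (2 * (Δ : ℝ) * (1 - (4 * (d : ℝ) + 5) / (4 * (r : ℝ))))
        (2 * (Δ : ℝ) * (1 - (q : ℝ) / ((q : ℝ) ^ 2 - 1))) := by
  have hr3 : 3 * (d + 1) ≤ r := hr ▸ Nat.mul_le_mul_right _ hq3
  have hbdd : BddAbove (constructionSizes r (d + 1) Δ) :=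
    ⟨_, fun n hn => Nat.le_floor (le_of_mem_constructionSizes hr hq3 hq hn)⟩
  have hmem : extremalSize r (d + 1) Δ ∈ constructionSizes r (d + 1) Δ :=
    Nat.sSup_mem ⟨0, zero_mem_constructionSizes (by omega) (by omega)⟩ hbdd
  exact ⟨⟨hmem, fun n hn => le_csSup hbdd hn⟩, le_of_mem_constructionSizes hr hq3 hq hmem⟩
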